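/- Let $G$ be a finite group, let $F\subseteq\mathbb{C}$ be a field, and let $E=F(\varepsilon)\subseteq\mathbb{C}$ for some root of unity $\varepsilon$. Let $G$ act on $E$ by field automorphisms fixing $F$ elementwise. Let $\mathrm{BrCliff}(G,E)$ be the Brauer-Clifford group: the group of equivalence classes of Azumaya $G$-algebras over $E$ (finite-dimensional central simple $E$-algebras with an action of $G$ by ring automorphisms extending the action on $E$), where $A$ and $B$ are equivalent if $A\otimes_E \mathrm{End}_E(P)\cong B\otimes_E\mathrm{End}_E(Q)$ as $G$-algebras over $E$ for some non-zero finite-dimensional modules $P,Q$ over the skew group algebra $EG$, with multiplication induced by $\otimes_E$. A Clifford pair over $G$ is a pair $(\theta,\kappa)$ where $\kappa\colon\widehat{G}\to G$ is a surjective homomorphism of finite groups and $\theta$ is an irreducible complex character of $N=\ker\kappa$. Let $e_{\theta}=\frac{\theta(1)}{|N|}\sum_{n\in N}\theta(n^{-1})n$, let $e_{\theta,F}=\sum_{\sigma\in\mathrm{Gal}(F(\theta)/F)}(e_\theta)^{\sigma}\in Z(FN)$, and let $(e_{\theta,F})^G$ be the sum of the distinct $\widehat{G}$-conjugates of $e_{\theta,F}$.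 The center algebra is $Z(\theta,\kappa,F)=Z(FN)(e_{\theta,F})^G$, on which $G\cong\widehat{G}/N$ acts by conjugation; the pair is semi-invariant over $F$ if $(e_{\theta,F})^G=e_{\theta,F}$ (equivalently, $Z(\theta,\kappa,F)$ is a field). The Brauer-Clifford class $[\![\theta,\kappa,F]\!]\in\mathrm{BrCliff}(G,Z(\theta,\kappa,F))$ is the class of $\mathrm{End}_{FN}(V)$, where $V$ is any non-zero finite-dimensional $F\widehat{G}$-module on which $(e_{\theta,F})^G$ acts as the identity. For a class $\mathcal{X}$ of Clifford pairs over $G$ let $$\mathrm{SC}_{\mathcal{X}}(G,E)=\{\overline{\alpha}[\![\theta,\kappa,F]\!] \mid (\theta,\kappa)\in\mathcal{X},\ \alpha\colon Z(\theta,\kappa,F)\to E \text{ an isomorphism of } G\text{-algebras over } F\},$$ where $\overline{\alpha}\colon\mathrm{BrCliff}(G,Z(\theta,\kappa,F))\to\mathrm{BrCliff}(G,E)$ is the isomorphism induced by $\alpha$. Let $\mathcal{C}$ (respectively $\mathcal{A}$) be the class of Clifford pairs $(\theta,\kappa)$ over $G$ that are semi-invariant over $F$ and such that $\ker\kappa$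 is cyclic (respectively abelian). Then $\mathrm{SC}_{\mathcal{C}}(G,E)$ is a subgroup of $\mathrm{BrCliff}(G,E)$, and $\mathrm{SC}_{\mathcal{C}}(G,E)=\mathrm{SC}_{\mathcal{A}}(G,E)$. -/

import Mathlib

open scoped TensorProduct

universe u v

noncomputable section

section BrauerClifford

variable {G : Type u} {R : Type v} [Group G] [CommRing R] [MulSemiringAction G R]

/-- The datum making an `R`-algebra `A` a `G`-algebra over the commutative `G`-ring `R`: an action
of `G` on `A` by ring automorphisms such that the unit map `R → A` (which is central) is
equivariant.  Actions are written on the left; the exponential notation of right actions is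
`a ^ g = g⁻¹ • a`. -/
structure GAlgAct (G : Type u) (R : Type v) [Group G] [CommRing R] [MulSemiringAction G R]
    (A : Type v) [Ring A] [Algebra R A] where
  act : G →* (A →+* A)
  act_algebraMap : ∀ (g : G) (r : R), act g (algebraMap R A r) = algebraMap R A (g • r)

/-- The datum making an `R`-module `P` a module over the skew group algebra of `G` over `R`:
an additive action of `G` such that `g (r p) = (g r) (g p)`. -/
structure GModAct (G : Type u) (R : Type v) [Group G] [CommRing R] [MulSemiringAction G R]
    (P : Type v) [AddCommGroup P] [Module R P] where
  act : G →* AddMonoid.End P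
  act_smul : ∀ (g : G) (r : R) (p : P), act g (r • p) = (g • r) • act g p

/-- The module `P` is a progenerator over `R`: it is finitely generated, projective and faithful
(for finitely generated projective modules over a commutative ring, being faithful is the same as
being a generator). -/
structure IsProgenerator (R : Type v) [CommRing R] (P : Type v) [AddCommGroup P] [Module R P] :
    Prop where
  finite : Module.Finite R P
  projective : Module.Projective R P
  faithful : FaithfulSMul R P

theorem tensor_addHom_ext {P Q M : Type*} [AddCommGroup P] [Module R P] [AddCommGroup Q]
    [Module R Q] [AddCommGroup M] {f g : P ⊗[R] Q →+ M}
    (h : ∀ p q, f (p ⊗ₜ[R] q) = g (p ⊗ₜ[R] q)) : f = g := by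
  ext x
  induction x with
  | zero => simp
  | add x y hx hy => rw [map_add, map_add, hx, hy]
  | tmul p q => exact h p q

namespace GModAct

variable {P Q : Type v} [AddCommGroup P] [Module R P] [AddCommGroup Q] [Module R Q]
  (σ : GModAct G R P) (τ : GModAct G R Q)

@[simp] theorem act_inv_act (g : G) (p : P) : σ.act g⁻¹ (σ.act g p) = p := by
  have := DFunLike.congr_fun (σ.act.map_mul g⁻¹ g) p
  simpa using this.symm

@[simp] theorem act_act_inv (g : G) (p : P) : σ.act g (σ.act g⁻¹ p) = p := by
  simpa using σ.act_inv_act g⁻¹ p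

/-- The action of `g` as a semilinear map. -/
def actₛₗ (g : G) : P →ₛₗ[MulSemiringAction.toRingHom G R g] P where
  toFun := σ.act g
  map_add' := map_add _
  map_smul' r a := σ.act_smul g r a

@[simp] theorem actₛₗ_apply (g : G) (p : P) : σ.actₛₗ g p = σ.act g p := rfl

/-- The `G`-algebra `End_R(P)`, on which `g` acts by conjugation: `f ↦ g ∘ f ∘ g⁻¹`. -/
def endAct : GAlgAct G R (Module.End R P) where
  act :=
    { toFun := fun g =>
        { toFun := fun f =>
            { toFun := fun p => σ.act g (f (σ.act g⁻¹ p))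
              map_add' := fun p q => by simp
              map_smul' := fun r p => by simp [act_smul] }
          map_one' := by ext p; simp
          map_mul' := fun f f' => by ext p; simp
          map_zero' := by ext p; simp
          map_add' := fun f f' => by ext p; simp }
      map_one' := by ext f p; simp
      map_mul' := fun g h => by ext f p; simp }
  act_algebraMap g r := by ext p; simp [Module.algebraMap_end_apply, act_smul]

@[simp] theorem endAct_apply (g : G) (f : Module.End R P) (p : P) :
    σ.endAct.act g f p = σ.act g (f (σ.act g⁻¹ p)) := rfl

/-- The tensor product over `R` with the diagonal action of `G`. -/
def tensor : GModAct G R (P ⊗[R] Q) where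
  act :=
    { toFun := fun g => ((TensorProduct.map (σ.actₛₗ g) (τ.actₛₗ g)).toAddMonoidHom :
        P ⊗[R] Q →+ P ⊗[R] Q)
      map_one' := by
        refine tensor_addHom_ext (R := R) fun p q => ?_
        change σ.act 1 p ⊗ₜ[R] τ.act 1 q = p ⊗ₜ[R] q
        simp
      map_mul' := fun g h => by
        refine tensor_addHom_ext (R := R) fun p q => ?_
        change σ.act (g * h) p ⊗ₜ[R] τ.act (g * h) q
            = σ.act g (σ.act h p) ⊗ₜ[R] τ.act g (τ.act h q)
        simp }
  act_smul g r x := map_smulₛₗ (TensorProduct.map (σ.actₛₗ g) (τ.actₛₗ g)) r x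

@[simp] theorem tensor_tmul (g : G) (p : P) (q : Q) :
    (σ.tensor τ).act g (p ⊗ₜ[R] q) = σ.act g p ⊗ₜ[R] τ.act g q := rfl

end GModAct

namespace GAlgAct

variable {A A' B B' C : Type v} [Ring A] [Algebra R A] [Ring A'] [Algebra R A']
  [Ring B] [Algebra R B] [Ring B'] [Algebra R B'] [Ring C] [Algebra R C]
  (α : GAlgAct G R A) (α' : GAlgAct G R A') (β : GAlgAct G R B) (β' : GAlgAct G R B')
  (γ : GAlgAct G R C)

theorem act_smul (g : G) (r : R) (a : A) : α.act g (r • a) = (g • r) • α.act g a := by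
  rw [Algebra.smul_def, map_mul, α.act_algebraMap, ← Algebra.smul_def]

/-- The underlying module over the skew group algebra. -/
def toMod : GModAct G R A where
  act :=
    { toFun := fun g => (α.act g).toAddMonoidHom
      map_one' := by rw [map_one]; rfl
      map_mul' := fun g h => by rw [map_mul]; rfl }
  act_smul := α.act_smul

@[simp] theorem toMod_act (g : G) (a : A) : α.toMod.act g a = α.act g a := rfl

variable (G R) in
/-- The `G`-ring `R` as a `G`-algebra over itself. -/
def unit : GAlgAct G R R where
  act :=
    { toFun := fun g => MulSemiringAction.toRingHom G R g
      map_one' := by ext r; simp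
      map_mul' := fun g h => by ext r; simp [mul_smul] }
  act_algebraMap _ _ := rfl

@[simp] theorem unit_act (g : G) (r : R) : (unit G R).act g r = g • r := rfl

/-- The opposite algebra. -/
def op : GAlgAct G R Aᵐᵒᵖ where
  act :=
    { toFun := fun g => (α.act g).op
      map_one' := by ext a; simp
      map_mul' := fun g h => by ext a; simp }
  act_algebraMap g r := by
    simp [MulOpposite.algebraMap_apply, α.act_algebraMap]

@[simp] theorem op_act (g : G) (a : Aᵐᵒᵖ) :
    α.op.act g a = MulOpposite.op (α.act g a.unop) := rfl

/-- The diagonal action of `g` on the tensor product over `R`. -/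
def tensorHom (g : G) : A ⊗[R] B →+* A ⊗[R] B :=
  { (α.toMod.tensor β.toMod).act g with
    map_one' := by
      change α.act g 1 ⊗ₜ[R] β.act g 1 = 1
      simp [Algebra.TensorProduct.one_def]
    map_mul' := fun x y => by
      change (α.toMod.tensor β.toMod).act g (x * y) =
        (α.toMod.tensor β.toMod).act g x * (α.toMod.tensor β.toMod).act g y
      induction x with
      | zero => simp
      | add x x' hx hx' => simp only [add_mul, map_add, hx, hx']
      | tmul a b =>
        induction y with
        | zero => simp
        | add y y' hy hy' => simp only [mul_add, map_add, hy, hy']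
        | tmul a' b' => simp }

theorem tensorHom_tmul (g : G) (a : A) (b : B) :
    α.tensorHom β g (a ⊗ₜ[R] b) = α.act g a ⊗ₜ[R] β.act g b := rfl

/-- The tensor product over `R` with the diagonal action of `G`. -/
def tensor : GAlgAct G R (A ⊗[R] B) where
  act :=
    { toFun := α.tensorHom β
      map_one' := by
        refine RingHom.coe_addMonoidHom_injective <| tensor_addHom_ext (R := R) fun a b => ?_
        change α.act 1 a ⊗ₜ[R] β.act 1 b = a ⊗ₜ[R] b
        simp
      map_mul' := fun g h => by
        refine RingHom.coe_addMonoidHom_injective <| tensor_addHom_ext (R := R) fun a b => ?_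
        change α.act (g * h) a ⊗ₜ[R] β.act (g * h) b
            = α.act g (α.act h a) ⊗ₜ[R] β.act g (β.act h b)
        simp }
  act_algebraMap g r := by
    change α.act g (algebraMap R A r) ⊗ₜ[R] β.act g 1 = _
    rw [α.act_algebraMap, map_one]
    rfl

@[simp] theorem tensor_tmul (g : G) (a : A) (b : B) :
    (α.tensor β).act g (a ⊗ₜ[R] b) = α.act g a ⊗ₜ[R] β.act g b := rfl

variable {α α' β β' γ}

/-- Isomorphism of `G`-algebras over `R`. -/
def Iso (α : GAlgAct G R A) (β : GAlgAct G R B) : Prop :=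
  ∃ e : A ≃ₐ[R] B, ∀ (g : G) (a : A), e (α.act g a) = β.act g (e a)

theorem Iso.refl (α : GAlgAct G R A) : Iso α α := ⟨AlgEquiv.refl, fun _ _ => rfl⟩

theorem Iso.symm : Iso α β → Iso β α := by
  rintro ⟨e, he⟩
  exact ⟨e.symm, fun g b => e.injective (by simp [he])⟩

theorem Iso.trans : Iso α β → Iso β γ → Iso α γ := by
  rintro ⟨e, he⟩ ⟨f, hf⟩
  exact ⟨e.trans f, fun g a => by simp [he, hf]⟩

/-- For an isomorphism out of a tensor product, equivariance can be checked on pure tensors. -/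
theorem iso_of_tmul (e : A ⊗[R] B ≃ₐ[R] C)
    (he : ∀ g a b, e (α.act g a ⊗ₜ[R] β.act g b) = γ.act g (e (a ⊗ₜ[R] b))) :
    Iso (α.tensor β) γ := by
  refine ⟨e, fun g x => ?_⟩
  induction x with
  | zero => simp
  | add x y hx hy => simp only [map_add, hx, hy]
  | tmul a b => exact he g a b

theorem tensor_comm (α : GAlgAct G R A) (β : GAlgAct G R B) :
    Iso (α.tensor β) (β.tensor α) :=
  iso_of_tmul (Algebra.TensorProduct.comm R A B) fun _ _ _ => rfl

theorem tensor_congr : Iso α α' → Iso β β' → Iso (α.tensor β) (α'.tensor β') := by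
  rintro ⟨e, he⟩ ⟨f, hf⟩
  exact iso_of_tmul (Algebra.TensorProduct.congr e f) fun g a b => by simp [he, hf]

theorem tensor_assoc (α : GAlgAct G R A) (β : GAlgAct G R B) (γ : GAlgAct G R C) :
    Iso ((α.tensor β).tensor γ) (α.tensor (β.tensor γ)) := by
  refine iso_of_tmul (Algebra.TensorProduct.assoc R R R A B C) fun g x c => ?_
  induction x with
  | zero => simp
  | add x y hx hy => simp only [TensorProduct.add_tmul, map_add, hx, hy]
  | tmul a b => simp

theorem unit_tensor (α : GAlgAct G R A) : Iso ((unit G R).tensor α) α :=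
  iso_of_tmul (Algebra.TensorProduct.lid R A) fun g r a => by simp [α.act_smul]

theorem tensor_tensor_comm (α : GAlgAct G R A) (β : GAlgAct G R B) (γ : GAlgAct G R C) :
    Iso ((α.tensor β).tensor γ) ((α.tensor γ).tensor β) :=
  (tensor_assoc α β γ).trans <|
    (tensor_congr (.refl α) (tensor_comm β γ)).trans (tensor_assoc α γ β).symm

/-- `R ≅ End_R(R)` as `G`-algebras. -/
theorem endAct_unit : Iso (unit G R) (unit G R).toMod.endAct :=
  ⟨AlgEquiv.ofBijective (Algebra.ofId R (Module.End R R)) ⟨fun r s h => by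
      simpa [Algebra.ofId_apply] using LinearMap.congr_fun h 1, fun f => ⟨f 1, by
      ext; simp⟩⟩, fun g r => by
    ext
    change (g • r) • (1 : R) = g • (r • (g⁻¹ • (1 : R)))
    simp⟩

/-- `A ⊗ Aᵒᵖ ≅ End_R(A)` as `G`-algebras, for an Azumaya `G`-algebra `A`. -/
theorem tensor_op [IsAzumaya R A] (α : GAlgAct G R A) : Iso (α.tensor α.op) α.toMod.endAct := by
  refine iso_of_tmul (AlgEquiv.ofBijective (AlgHom.mulLeftRight R A) IsAzumaya.bij) ?_
  intro g a b
  ext x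
  have : α.act g (α.act g⁻¹ x) = x := α.toMod.act_act_inv g x
  simp [this]

end GAlgAct

section Azumaya

variable {A B : Type v} [Ring A] [Algebra R A] [Ring B] [Algebra R B]
variable {P Q : Type v} [AddCommGroup P] [Module R P] [AddCommGroup Q] [Module R Q]

theorem faithfulSMul_of_algebraMap_injective (h : Function.Injective (algebraMap R A)) :
    FaithfulSMul R A :=
  (faithfulSMul_iff_algebraMap_injective R A).2 h

theorem algebraMap_tensor_injective [Module.Flat R A]
    (hA : Function.Injective (algebraMap R A)) (hB : Function.Injective (algebraMap R B)) :
    Function.Injective (algebraMap R (A ⊗[R] B)) := by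
  rw [Algebra.TensorProduct.algebraMap_def]
  exact (Algebra.TensorProduct.includeLeft_injective (S := R) hB).comp hA

theorem homTensorHomMap_bijective [Module.Finite R P] [Module.Projective R P]
    [Module.Finite R Q] [Module.Projective R Q] :
    Function.Bijective (TensorProduct.homTensorHomMap (.id R) P Q P Q) := by
  rw [← homTensorHomEquiv_toLinearMap]
  exact (homTensorHomEquiv R P Q P Q).bijective

theorem exists_mulLeftRight_equiv [IsAzumaya R A] :
    ∃ e : A ⊗[R] Aᵐᵒᵖ ≃ₗ[R] Module.End R A, ∀ z, e z = AlgHom.mulLeftRight R A z :=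
  ⟨LinearEquiv.ofBijective (AlgHom.mulLeftRight R A).toLinearMap IsAzumaya.bij, fun _ => rfl⟩

/-- The tensor product of Azumaya algebras is Azumaya. -/
theorem IsAzumaya.tensor [IsAzumaya R A] [IsAzumaya R B] : IsAzumaya R (A ⊗[R] B) where
  toProjective := inferInstance
  toFaithfulSMul := faithfulSMul_of_algebraMap_injective <| algebraMap_tensor_injective
    (FaithfulSMul.algebraMap_injective R A) (FaithfulSMul.algebraMap_injective R B)
  toFinite := inferInstance
  bij := by
    let e₁ : (A ⊗[R] B) ⊗[R] (A ⊗[R] B)ᵐᵒᵖ ≃ₗ[R] (A ⊗[R] Aᵐᵒᵖ) ⊗[R] (B ⊗[R] Bᵐᵒᵖ) :=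
      (TensorProduct.congr (.refl R _) (Algebra.TensorProduct.opAlgEquiv R R A B).symm.toLinearEquiv).trans
        (TensorProduct.tensorTensorTensorComm R A B Aᵐᵒᵖ Bᵐᵒᵖ)
    obtain ⟨eA, hA⟩ := exists_mulLeftRight_equiv (R := R) (A := A)
    obtain ⟨eB, hB⟩ := exists_mulLeftRight_equiv (R := R) (A := B)
    let e₂ := TensorProduct.congr eA eB
    have h := homTensorHomMap_bijective (R := R) (P := A) (Q := B) |>.comp
      ((e₁.trans e₂).bijective)
    convert! h
    funext z
    induction z with
    | zero => simp
    | add z z' hz hz' => simp only [map_add, hz, hz', Function.comp_apply]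
    | tmul x y =>
      obtain ⟨y, rfl⟩ := MulOpposite.op_surjective y
      induction x with
      | zero => simp
      | add x x' hx hx' =>
        simp only [TensorProduct.add_tmul, map_add, hx, hx', Function.comp_apply]
      | tmul a b =>
        induction y with
        | zero => simp
        | add y y' hy hy' =>
          simp only [MulOpposite.op_add, TensorProduct.tmul_add, map_add, hy, hy',
            Function.comp_apply]
        | tmul a' b' =>
          ext a₀ b₀
          simp [e₁, e₂, hA, hB]

/-- The opposite of an Azumaya algebra is Azumaya. -/
theorem IsAzumaya.op [IsAzumaya R A] : IsAzumaya R Aᵐᵒᵖ where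
  toProjective := .of_equiv (MulOpposite.opLinearEquiv R (M := A))
  toFaithfulSMul := faithfulSMul_of_algebraMap_injective <|
    MulOpposite.op_injective.comp (FaithfulSMul.algebraMap_injective R A)
  toFinite := .equiv (MulOpposite.opLinearEquiv R (M := A))
  bij := by
    let e₁ : Aᵐᵒᵖ ⊗[R] Aᵐᵒᵖᵐᵒᵖ ≃ₗ[R] A ⊗[R] Aᵐᵒᵖ :=
      (TensorProduct.comm R _ _).trans
        (TensorProduct.congr (AlgEquiv.opOp R A).symm.toLinearEquiv (.refl R _))
    obtain ⟨e₂, h₂⟩ := exists_mulLeftRight_equiv (R := R) (A := A)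
    let e₃ := (MulOpposite.opLinearEquiv R (M := A)).conj
    convert! ((e₁.trans e₂).trans e₃).bijective
    funext z
    induction z with
    | zero => simp
    | add z z' hz hz' => simp only [map_add, hz, hz']
    | tmul a b =>
      ext x
      apply MulOpposite.unop_injective
      simp [e₁, h₂, e₃, LinearEquiv.conj_apply, mul_assoc]

theorem IsProgenerator.self : IsProgenerator R R := ⟨inferInstance, inferInstance, inferInstance⟩

theorem IsAzumaya.isProgenerator [IsAzumaya R A] : IsProgenerator R A :=
  ⟨inferInstance, inferInstance, inferInstance⟩

theorem IsProgenerator.algebraMap_end_injective (h : IsProgenerator R P) :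
    Function.Injective (algebraMap R (Module.End R P)) := fun r s hrs =>
  h.faithful.eq_of_smul_eq_smul fun p => by simpa using LinearMap.congr_fun hrs p

theorem IsProgenerator.tensor (hP : IsProgenerator R P) (hQ : IsProgenerator R Q) :
    IsProgenerator R (P ⊗[R] Q) := by
  obtain ⟨_, _, _⟩ := id hP
  obtain ⟨_, _, _⟩ := id hQ
  refine ⟨inferInstance, inferInstance, ⟨fun {r s} h => ?_⟩⟩
  refine hP.faithful.eq_of_smul_eq_smul fun p => ?_
  rw [← sub_eq_zero, ← sub_smul, ← Module.forall_dual_apply_eq_zero_iff R]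
  intro f
  rw [map_smul, smul_eq_mul, sub_mul, sub_eq_zero]
  refine hQ.faithful.eq_of_smul_eq_smul fun q => ?_
  have := congrArg ((TensorProduct.lid R Q).toLinearMap ∘ₗ TensorProduct.map f LinearMap.id)
    (h (p ⊗ₜ[R] q))
  simpa [smul_smul] using this

theorem GModAct.endAct_tensor (hP : IsProgenerator R P) (hQ : IsProgenerator R Q)
    (σ : GModAct G R P) (τ : GModAct G R Q) :
    (σ.endAct.tensor τ.endAct).Iso (σ.tensor τ).endAct := by
  obtain ⟨_, _, _⟩ := hP
  obtain ⟨_, _, _⟩ := hQ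
  refine GAlgAct.iso_of_tmul (AlgEquiv.ofBijective (Module.endTensorEndAlgHom (S := R) (A := R) (R := R)) ?_) ?_
  · convert! homTensorHomMap_bijective (R := R) (P := P) (Q := Q)
  · intro g f f'
    ext p q
    have h (φ : Module.End R P) (ψ : Module.End R Q) (x : P) (y : Q) :
        (Module.endTensorEndAlgHom (S := R) (A := R) (R := R) (φ ⊗ₜ[R] ψ)) (x ⊗ₜ[R] y) =
          φ x ⊗ₜ[R] ψ y := rfl
    simp [h]

end Azumaya

variable (G R) in
/-- Azumaya `G`-algebras over the commutative `G`-ring `R`. -/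
structure AzumayaGAlg where
  carrier : Type v
  [ring : Ring carrier]
  [algebra : Algebra R carrier]
  [azumaya : IsAzumaya R carrier]
  action : GAlgAct G R carrier

namespace AzumayaGAlg

attribute [instance] ring algebra azumaya

/-- `A` and `B` are equivalent if `A ⊗ End_R(P) ≅ B ⊗ End_R(Q)` as `G`-algebras over `R`, for
some modules `P` and `Q` over the skew group algebra which are progenerators over `R`. -/
def Equivalent (A B : AzumayaGAlg G R) : Prop :=
  ∃ (P : Type v) (_ : AddCommGroup P) (_ : Module R P) (σ : GModAct G R P)
    (Q : Type v) (_ : AddCommGroup Q) (_ : Module R Q) (τ : GModAct G R Q),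
    IsProgenerator R P ∧ IsProgenerator R Q ∧
      (A.action.tensor σ.endAct).Iso (B.action.tensor τ.endAct)

theorem equivalent_of_iso {A B : AzumayaGAlg G R} (h : A.action.Iso B.action) :
    A.Equivalent B :=
  ⟨R, _, _, (GAlgAct.unit G R).toMod, R, _, _, (GAlgAct.unit G R).toMod,
    IsProgenerator.self, IsProgenerator.self, GAlgAct.tensor_congr h (.refl _)⟩

theorem Equivalent.symm {A B : AzumayaGAlg G R} : A.Equivalent B → B.Equivalent A := by
  rintro ⟨P, _, _, σ, Q, _, _, τ, hP, hQ, h⟩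
  exact ⟨Q, _, _, τ, P, _, _, σ, hQ, hP, h.symm⟩

theorem Equivalent.trans {A B C : AzumayaGAlg G R} :
    A.Equivalent B → B.Equivalent C → A.Equivalent C := by
  rintro ⟨P, _, _, σ, Q, _, _, τ, hP, hQ, h⟩ ⟨P', _, _, σ', Q', _, _, τ', hP', hQ', h'⟩
  refine ⟨_, _, _, σ.tensor σ', _, _, _, τ'.tensor τ, hP.tensor hP', hQ'.tensor hQ, ?_⟩
  have h₁ := GAlgAct.tensor_congr (.refl A.action) (GModAct.endAct_tensor hP hP' σ σ').symm
  have h₂ := h₁.trans (GAlgAct.tensor_assoc A.action σ.endAct σ'.endAct).symm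
  have h₃ := h₂.trans (GAlgAct.tensor_congr h (.refl σ'.endAct))
  have h₄ := h₃.trans (GAlgAct.tensor_tensor_comm B.action τ.endAct σ'.endAct)
  have h₅ := h₄.trans (GAlgAct.tensor_congr h' (.refl τ.endAct))
  have h₆ := h₅.trans (GAlgAct.tensor_assoc C.action τ'.endAct τ.endAct)
  exact h₆.trans (GAlgAct.tensor_congr (.refl C.action) (GModAct.endAct_tensor hQ' hQ τ' τ))

instance setoid : Setoid (AzumayaGAlg G R) where
  r := Equivalent
  iseqv := ⟨fun _ => equivalent_of_iso (.refl _), .symm, .trans⟩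

variable (G R) in
/-- `R` as an Azumaya `G`-algebra over itself. -/
def unit : AzumayaGAlg G R := ⟨R, GAlgAct.unit G R⟩

/-- The tensor product of Azumaya `G`-algebras. -/
def tensor (A B : AzumayaGAlg G R) : AzumayaGAlg G R :=
  haveI := IsAzumaya.tensor (R := R) (A := A.carrier) (B := B.carrier)
  ⟨A.carrier ⊗[R] B.carrier, A.action.tensor B.action⟩

/-- The opposite of an Azumaya `G`-algebra. -/
def op (A : AzumayaGAlg G R) : AzumayaGAlg G R :=
  haveI := IsAzumaya.op (R := R) (A := A.carrier)
  ⟨A.carrierᵐᵒᵖ, A.action.op⟩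

theorem Equivalent.tensor_right {A A' : AzumayaGAlg G R} (B : AzumayaGAlg G R) :
    A.Equivalent A' → (A.tensor B).Equivalent (A'.tensor B) := by
  rintro ⟨P, _, _, σ, Q, _, _, τ, hP, hQ, h⟩
  refine ⟨P, _, _, σ, Q, _, _, τ, hP, hQ, ?_⟩
  exact ((GAlgAct.tensor_tensor_comm A.action B.action σ.endAct).trans
    (GAlgAct.tensor_congr h (.refl B.action))).trans
    (GAlgAct.tensor_tensor_comm A'.action τ.endAct B.action)

theorem tensor_comm_equivalent (A B : AzumayaGAlg G R) :
    (A.tensor B).Equivalent (B.tensor A) :=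
  equivalent_of_iso (GAlgAct.tensor_comm A.action B.action)

theorem Equivalent.tensor {A A' B B' : AzumayaGAlg G R} (h : A.Equivalent A')
    (h' : B.Equivalent B') : (A.tensor B).Equivalent (A'.tensor B') :=
  (h.tensor_right B).trans <| (tensor_comm_equivalent A' B).trans <|
    (h'.tensor_right A').trans (tensor_comm_equivalent B' A')

theorem Equivalent.tensor_left {B B' : AzumayaGAlg G R} (A : AzumayaGAlg G R)
    (h : B.Equivalent B') : (A.tensor B).Equivalent (A.tensor B') :=
  Equivalent.tensor (equivalent_of_iso (.refl _)) h

theorem op_tensor_equivalent (A : AzumayaGAlg G R) : (A.op.tensor A).Equivalent (unit G R) := by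
  refine ⟨R, _, _, (GAlgAct.unit G R).toMod, A.carrier, _, _, A.action.toMod,
    IsProgenerator.self, IsAzumaya.isProgenerator, ?_⟩
  have h : (A.action.op.tensor A.action).Iso A.action.toMod.endAct :=
    (GAlgAct.tensor_comm _ _).trans (GAlgAct.tensor_op A.action)
  refine (GAlgAct.tensor_congr h ?_).trans (GAlgAct.tensor_comm _ (GAlgAct.unit G R))
  exact GAlgAct.endAct_unit.symm

theorem Equivalent.op {A B : AzumayaGAlg G R} (h : A.Equivalent B) : A.op.Equivalent B.op := by
  have h₁ : A.op.Equivalent ((A.op.tensor B).tensor B.op) := by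
    refine (equivalent_of_iso (GAlgAct.unit_tensor A.op.action).symm :
      A.op.Equivalent ((unit G R).tensor A.op)).trans ?_
    refine ((op_tensor_equivalent B).symm.tensor_right A.op).trans ?_
    refine (tensor_comm_equivalent _ _).trans ?_
    refine (((tensor_comm_equivalent B.op B)).tensor_left A.op).trans ?_
    exact equivalent_of_iso (GAlgAct.tensor_assoc _ _ _).symm
  refine h₁.trans ?_
  refine ((((h.symm).tensor_left A.op).trans (op_tensor_equivalent A)).tensor_right B.op).trans ?_
  exact equivalent_of_iso (GAlgAct.unit_tensor B.op.action)

end AzumayaGAlg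

variable (G R) in
/-- The Brauer-Clifford group of the commutative `G`-ring `R`: equivalence classes of Azumaya
`G`-algebras over `R`. -/
def BrCliff : Type (max u (v + 1)) := Quotient (AzumayaGAlg.setoid (G := G) (R := R))

namespace BrCliff

/-- The class of an Azumaya `G`-algebra. -/
def mk (A : AzumayaGAlg G R) : BrCliff G R := Quotient.mk _ A

/-- The multiplication is induced by the tensor product over `R`. -/
instance : CommGroup (BrCliff G R) where
  mul := Quotient.map₂ AzumayaGAlg.tensor fun _ _ h _ _ h' => h.tensor h'
  one := mk (AzumayaGAlg.unit G R)
  inv := Quotient.map AzumayaGAlg.op fun _ _ h => h.op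
  mul_assoc := by
    rintro ⟨A⟩ ⟨B⟩ ⟨C⟩
    exact Quotient.sound (AzumayaGAlg.equivalent_of_iso
      (GAlgAct.tensor_assoc A.action B.action C.action))
  mul_comm := by
    rintro ⟨A⟩ ⟨B⟩
    exact Quotient.sound (AzumayaGAlg.tensor_comm_equivalent A B)
  one_mul := by
    rintro ⟨A⟩
    exact Quotient.sound (AzumayaGAlg.equivalent_of_iso (GAlgAct.unit_tensor A.action))
  mul_one := by
    rintro ⟨A⟩
    exact Quotient.sound ((AzumayaGAlg.tensor_comm_equivalent _ _).trans
      (AzumayaGAlg.equivalent_of_iso (GAlgAct.unit_tensor A.action)))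
  inv_mul_cancel := by
    rintro ⟨A⟩
    exact Quotient.sound (AzumayaGAlg.op_tensor_equivalent A)

theorem mk_eq_mk {A B : AzumayaGAlg G R} : mk A = mk B ↔ A.Equivalent B := Quotient.eq

theorem mk_mul_mk (A B : AzumayaGAlg G R) : mk A * mk B = mk (A.tensor B) := rfl

theorem inv_mk (A : AzumayaGAlg G R) : (mk A)⁻¹ = mk A.op := rfl

theorem one_def : (1 : BrCliff G R) = mk (AzumayaGAlg.unit G R) := rfl

end BrCliff

end BrauerClifford

/-! ### Clifford pairs -/

section CliffordPairs

/-- `θ` is the character of an irreducible complex representation of `N`. -/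
def IsIrrChar {N : Type} [Group N] (θ : N → ℂ) : Prop :=
  ∃ (V : Type) (_ : AddCommGroup V) (_ : Module ℂ V) (_ : FiniteDimensional ℂ V)
    (ρ : Representation ℂ N V), ρ.IsIrreducible ∧ ρ.character = θ

/-- A Clifford pair `(θ, κ)` over `G`: a surjective homomorphism `κ : Ĝ → G` from a finite group
`Ĝ`, and an irreducible complex character `θ` of its kernel `N`.  (A finite group has a copy in
`Type`, so that it is no restriction to take `Ĝ` there.) -/
structure CliffordPair (G : Type u) [Group G] where
  Ghat : Type
  [group : Group Ghat]
  [finite : Finite Ghat]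
  κ : Ghat →* G
  surjective : Function.Surjective κ
  θ : κ.ker → ℂ
  irr : IsIrrChar θ

namespace CliffordPair

attribute [instance] group finite

variable {G : Type u} [Group G] (P : CliffordPair G) (F : Subfield ℂ)

/-- The kernel `N` of `κ`. -/
abbrev N : Subgroup P.Ghat := P.κ.ker

/-- The field of values `F(θ)`. -/
def fieldOfValues : IntermediateField F ℂ := IntermediateField.adjoin F (Set.range P.θ)

theorem θ_mem (n : P.N) : P.θ n ∈ P.fieldOfValues F :=
  IntermediateField.subset_adjoin _ _ ⟨n, rfl⟩

/-- The coefficient `θ(1) θ(n⁻¹) / |N|` at `n` of the primitive idempotent `e_θ` of `Z(ℂN)`, as an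
element of `F(θ)`. -/
def eCoeff (n : P.N) : P.fieldOfValues F :=
  ⟨P.θ 1 / (Nat.card P.N : ℂ) * P.θ n⁻¹,
    mul_mem (div_mem (P.θ_mem F 1) (natCast_mem _ _)) (P.θ_mem F n⁻¹)⟩

theorem root_of_unity_mem_of_isIrrChar {N : Type} [Group N] [Finite N] {θ : N → ℂ}
    (hθ : IsIrrChar θ) (n : N) {ζ : ℂ} (hζ : IsPrimitiveRoot ζ (Nat.card N)) :
    θ n ∈ IntermediateField.adjoin F {ζ} := by
  obtain ⟨V, _, _, _, ρ, -, rfl⟩ := hθ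
  rw [Representation.character, Module.End.trace_eq_sum_roots_charpoly_of_splits
    (IsAlgClosed.splits _)]
  refine multiset_sum_mem _ fun μ hμ => ?_
  have h1 : Module.End.HasEigenvalue (ρ n) μ := by
    rw [Module.End.hasEigenvalue_iff_isRoot_charpoly]
    exact (Polynomial.mem_roots'.1 hμ).2
  obtain ⟨v, hv⟩ := h1.exists_hasEigenvector
  have h2 : μ ^ Nat.card N = 1 := by
    have := hv.pow_apply (Nat.card N)
    rw [← map_pow, pow_card_eq_one', map_one, Module.End.one_apply] at this
    have h3 : (μ ^ Nat.card N - 1) • v = 0 := by rw [sub_smul, ← this, one_smul, sub_self]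
    exact sub_eq_zero.1 ((smul_eq_zero.1 h3).resolve_right hv.2)
  have : NeZero (Nat.card N) := ⟨Nat.card_pos.ne'⟩
  obtain ⟨i, -, rfl⟩ := hζ.eq_pow_of_pow_eq_one h2
  exact pow_mem (IntermediateField.mem_adjoin_simple_self F ζ) i

/-- `F(θ)` is an abelian extension of `F`, of finite degree. -/
theorem isAbelianGalois_fieldOfValues :
    IsAbelianGalois F (P.fieldOfValues F) ∧ FiniteDimensional F (P.fieldOfValues F) := by
  have h0 : Nat.card P.N ≠ 0 := Nat.card_pos.ne'
  have : NeZero (Nat.card P.N) := ⟨h0⟩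
  have hζ := Complex.isPrimitiveRoot_exp (Nat.card P.N) h0
  set ζ := Complex.exp (2 * Real.pi * Complex.I / (Nat.card P.N : ℕ)) with hdef
  have hle : P.fieldOfValues F ≤ IntermediateField.adjoin F {ζ} :=
    IntermediateField.adjoin_le_iff.2 <| by
      rintro _ ⟨n, rfl⟩
      exact root_of_unity_mem_of_isIrrChar F P.irr n hζ
  have : IsCyclotomicExtension {Nat.card P.N} F (IntermediateField.adjoin F {ζ}) :=
    by
      have := hζ.adjoin_isCyclotomicExtension F
      have hi : IsIntegral F ζ :=
        ⟨Polynomial.X ^ Nat.card P.N - 1, by simpa using Polynomial.monic_X_pow_sub_C (1 : F) h0, by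
          rw [Polynomial.eval₂_sub, Polynomial.eval₂_X_pow, Polynomial.eval₂_one, hζ.pow_eq_one,
            sub_self]⟩
      have he := IntermediateField.adjoin_simple_toSubalgebra_of_isAlgebraic hi.isAlgebraic
      change IsCyclotomicExtension _ F (IntermediateField.adjoin F {ζ}).toSubalgebra
      rw [he]
      exact this
  have : IsAbelianGalois F (IntermediateField.adjoin F {ζ}) :=
    IsCyclotomicExtension.isAbelianGalois {Nat.card P.N} F _
  have : FiniteDimensional F (IntermediateField.adjoin F {ζ}) :=
    IsCyclotomicExtension.finiteDimensional {Nat.card P.N} F _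
  exact ⟨.of_algHom (IntermediateField.inclusion hle),
    .of_injective (IntermediateField.inclusion hle).toLinearMap
      (IntermediateField.inclusion hle).injective⟩

/-- The group algebra `FN`. -/
abbrev FN : Type := MonoidAlgebra F P.N

/-- The idempotent `e_{θ,F}` of `Z(FN)`: the sum of the Galois conjugates of `e_θ` over
`Gal(F(θ)/F)`, that is, the trace from `F(θ)` to `F` applied to the coefficients of `e_θ`. -/
def eF : P.FN F := ∑ᶠ n : P.N, MonoidAlgebra.single n (Algebra.trace F _ (P.eCoeff F n))

/-- The coefficients of `e_{θ,F}` are the sums of the Galois conjugates of those of `e_θ`. -/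
theorem eF_coeff (n : P.N) : algebraMap F (P.fieldOfValues F) ((P.eF F).coeff n) =
    ∑ᶠ σ : P.fieldOfValues F ≃ₐ[F] P.fieldOfValues F, σ (P.eCoeff F n) := by
  obtain ⟨_, _⟩ := P.isAbelianGalois_fieldOfValues F
  have := Fintype.ofFinite P.N
  rw [eF, finsum_eq_sum_of_fintype, finsum_eq_sum_of_fintype,
    ← trace_eq_sum_automorphisms (K := F)]
  congr 1
  classical
  simp [Finsupp.single_apply]

/-- The action of `Ĝ` on `FN` by conjugation. -/
def conjFN (g : P.Ghat) : P.FN F ≃ₐ[F] P.FN F :=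
  MonoidAlgebra.domCongr F F (MulAut.conjNormal g)

theorem conjFN_mul (g h : P.Ghat) (x : P.FN F) :
    P.conjFN F (g * h) x = P.conjFN F g (P.conjFN F h x) := by
  ext n
  rw [conjFN, map_mul]
  simp [conjFN]
  rfl

theorem conjFN_single_mul (n : P.N) (c : F) (x : P.FN F) :
    P.conjFN F n x * MonoidAlgebra.single n c = MonoidAlgebra.single n c * x := by
  induction x using MonoidAlgebra.induction_linear with
  | zero => simp
  | add x y hx hy => rw [map_add, add_mul, mul_add, hx, hy]
  | single m d =>
    have : (MulAut.conjNormal (n : P.Ghat) m : P.N) * n = n * m := by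
      ext
      simp
    simp [conjFN, MonoidAlgebra.single_mul_single, this, mul_comm]

/-- The idempotent `(e_{θ,F})^G`: the sum of the different conjugates of `e_{θ,F}` under `Ĝ`. -/
def eG : P.FN F := ∑ᶠ x ∈ Set.range (fun g : P.Ghat => P.conjFN F g (P.eF F)), x

theorem conjFN_eG (g : P.Ghat) : P.conjFN F g (P.eG F) = P.eG F := by
  have hfin : (Set.range (fun g : P.Ghat => P.conjFN F g (P.eF F))).Finite := Set.finite_range _
  refine (AddEquiv.map_finsum_mem (P.conjFN F g).toRingEquiv.toAddEquiv (fun x => x) hfin).trans ?_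
  refine finsum_mem_eq_of_bijOn (P.conjFN F g) ⟨?_, (P.conjFN F g).injective.injOn, ?_⟩
    fun _ _ => rfl
  · rintro _ ⟨h, rfl⟩
    exact ⟨g * h, P.conjFN_mul F g h _⟩
  · rintro _ ⟨h, rfl⟩
    exact ⟨_, ⟨g⁻¹ * h, rfl⟩, by simp [← conjFN_mul]⟩

theorem eG_mem_center : P.eG F ∈ Subalgebra.center F (P.FN F) := by
  rw [Subalgebra.mem_center_iff]
  intro b
  induction b using MonoidAlgebra.induction_linear with
  | zero => simp
  | add b b' hb hb' => rw [add_mul, mul_add, hb, hb']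
  | single n c =>
    have h := P.conjFN_single_mul F n c (P.eG F)
    rw [conjFN_eG] at h
    exact h.symm

/-- The center algebra `Z(θ, κ, F) = Z(FN) (e_{θ,F})^G`, as an `F`-algebra (with unit element
`(e_{θ,F})^G`). -/
def centerAlgebra : NonUnitalSubalgebra F (P.FN F) where
  carrier := {x | ∃ z ∈ Subalgebra.center F (P.FN F), x = z * P.eG F}
  zero_mem' := ⟨0, zero_mem _, by simp⟩
  add_mem' := by
    rintro _ _ ⟨z, hz, rfl⟩ ⟨w, hw, rfl⟩
    exact ⟨z + w, add_mem hz hw, by rw [add_mul]⟩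
  mul_mem' := by
    rintro _ _ ⟨z, hz, rfl⟩ ⟨w, hw, rfl⟩
    exact ⟨z * P.eG F * w, mul_mem (mul_mem hz (P.eG_mem_center F)) hw, by simp only [mul_assoc]⟩
  smul_mem' := by
    rintro c _ ⟨z, hz, rfl⟩
    exact ⟨c • z, Subalgebra.smul_mem _ hz c, by rw [smul_mul_assoc]⟩

theorem conjFN_mem (g : P.Ghat) {z : P.FN F} (hz : z ∈ P.centerAlgebra F) :
    P.conjFN F g z ∈ P.centerAlgebra F := by
  obtain ⟨z, hz, rfl⟩ := hz
  refine ⟨P.conjFN F g z, ?_, by rw [map_mul, conjFN_eG]⟩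
  rw [Subalgebra.mem_center_iff] at hz ⊢
  intro b
  obtain ⟨b, rfl⟩ := (P.conjFN F g).surjective b
  rw [← map_mul, hz, map_mul]

/-- The action of `Ĝ` on the center algebra; since `N` acts trivially, this is an action of
`G ≅ Ĝ/N`. -/
def conjZ (g : P.Ghat) (z : P.centerAlgebra F) : P.centerAlgebra F :=
  ⟨P.conjFN F g z, P.conjFN_mem F g z.2⟩

/-- `(θ, κ)` is semi-invariant over `F`: the idempotent `e_{θ,F}` is invariant under `Ĝ`
(equivalently, `Z(θ, κ, F)` is a field). -/
def IsSemiInvariant : Prop := ∀ g : P.Ghat, P.conjFN F g (P.eF F) = P.eF F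

variable {F}

/-- Isomorphisms `Z(θ, κ, F) → R` of `G`-algebras over `F`. -/
structure CenterIso (P : CliffordPair G) (F : Subfield ℂ) (R : Type) [CommRing R] [Algebra F R]
    [MulSemiringAction G R] extends P.centerAlgebra F ≃+* R where
  map_smul : ∀ (c : F) (z : P.centerAlgebra F), toFun (c • z) = c • toFun z
  map_conj : ∀ (g : P.Ghat) (z : P.centerAlgebra F), toFun (P.conjZ F g z) = P.κ g • toFun z

variable {V : Type} [AddCommGroup V] [Module F V]

/-- The action of `FN` on an `FĜ`-module. -/
def actFN (ρ : Representation F P.Ghat V) : P.FN F →ₐ[F] Module.End F V :=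
  Representation.asAlgebraHom (ρ.comp P.N.subtype)

/-- The `FĜ`-module `V` is `θ`-quasihomogeneous: it is non-zero, of finite dimension, and
`(e_{θ,F})^G V = V`. -/
structure IsQuasihomogeneous (ρ : Representation F P.Ghat V) : Prop where
  nontrivial : Nontrivial V
  finite : FiniteDimensional F V
  eG_act : P.actFN ρ (P.eG F) = 1

/-- `S = End_{FN}(V)`. -/
def endFN (ρ : Representation F P.Ghat V) : Subalgebra F (Module.End F V) :=
  Subalgebra.centralizer F (Set.range fun n : P.N => ρ n)

variable {R : Type} [CommRing R] [Algebra F R] [MulSemiringAction G R]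

/-- The `G`-algebra `A` over `R` is isomorphic to `S = End_{FN}(V)`, viewed as a `G`-algebra over
`R` by means of `α : Z(θ, κ, F) ≅ R`: the element `α z` of `R` acts as multiplication by `z`, and
`κ g` acts as conjugation with the action of `g` on `V`. -/
def IsSchurAlg (α : P.CenterIso F R) (ρ : Representation F P.Ghat V) (A : AzumayaGAlg G R) :
    Prop :=
  ∃ φ : A.carrier ≃+* P.endFN ρ,
    (∀ z : P.centerAlgebra F,
      (φ (algebraMap R A.carrier (α.toRingEquiv z)) : Module.End F V) = P.actFN ρ z) ∧
    ∀ (g : P.Ghat) (a : A.carrier),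
      (φ (A.action.act (P.κ g) a) : Module.End F V) = ρ g * φ a * ρ g⁻¹

/-- `c` is the image `ᾱ[[θ, κ, F]]` in `BrCliff(G, R)` of the Brauer-Clifford class of `(θ, κ)`
over `F`, for the isomorphism `α : Z(θ, κ, F) ≅ R`: the class of `End_{FN}(V)` for a
`θ`-quasihomogeneous module `V`.  (The class does not depend on `V`.) -/
def IsBrCliffClass (α : P.CenterIso F R) (c : BrCliff G R) : Prop :=
  ∃ (V : Type) (_ : AddCommGroup V) (_ : Module F V) (ρ : Representation F P.Ghat V)
    (A : AzumayaGAlg G R), P.IsQuasihomogeneous ρ ∧ P.IsSchurAlg α ρ A ∧ c = BrCliff.mk A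

end CliffordPair

variable {G : Type u} [Group G]

/-- The restricted Schur-Clifford subset `SC_X(G, R)` (over `F`) of `BrCliff(G, R)`, for a class
`X` of Clifford pairs over `G`: the set of all `ᾱ[[θ, κ, F]]` with `(θ, κ)` in `X` and
`α : Z(θ, κ, F) ≅ R` an isomorphism of `G`-algebras over `F`. -/
def SC (F : Subfield ℂ) (R : Type) [CommRing R] [Algebra F R] [MulSemiringAction G R]
    (X : Set (CliffordPair G)) : Set (BrCliff G R) :=
  {c | ∃ P ∈ X, ∃ α : P.CenterIso F R, P.IsBrCliffClass α c}

/-- The class of semi-invariant Clifford pairs whose kernel is cyclic. -/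
def cyclicKernelClass (G : Type u) [Group G] (F : Subfield ℂ) : Set (CliffordPair G) :=
  {P | P.IsSemiInvariant F ∧ IsCyclic P.κ.ker}

/-- The class of semi-invariant Clifford pairs whose kernel is abelian. -/
def abelianKernelClass (G : Type u) [Group G] (F : Subfield ℂ) : Set (CliffordPair G) :=
  {P | P.IsSemiInvariant F ∧ ∀ m n : P.κ.ker, m * n = n * m}

end CliffordPairs

end

/-! Both sets of classes equal a third one, which is visibly closed under the group operations: the
classes of $\mathrm{End}_E(V)$, where $V \ne 0$ is a finite-dimensional $E$-space on which a finite
group $H$ mapping onto $G$ acts semilinearly, so that the kernel of $H \to G$ acts by scalars which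
generate $E$ over $F$. Conjugation by scalars is trivial, so $G$ acts on $\mathrm{End}_E(V)$,
although it need not act on $V$.

Given a pair with abelian kernel $N$, the commutative algebra $FN$ acts on a quasihomogeneous $V$
through $Z(\theta,\kappa,F) \cong E$. Hence $N$ acts by scalars spanning $E$, and
$\mathrm{End}_{FN}(V) = \mathrm{End}_E(V)$ (`CenterIso.exists_scalarKernelModule`).

Conversely, divide $H$ by the elements of the kernel that act trivially on $V$. The kernel then
embeds in $E^\times$, so it is cyclic (`isCyclic_ker_reduce`), and its scalars form a linear
character $l$ of it. Since $l$ is equivariant and generates $E$, its field of values is $E$, the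
idempotent $e_{\theta,F}$ is invariant, and orthogonality of $l$ to its other Galois conjugates
makes $l$ induce an isomorphism of the center algebra with $E$ (`lift_eF`,
`lift_centerAlgebra_bijective`). So $\mathrm{End}_E(V)$ represents the class of a semi-invariant
pair with cyclic kernel.

Products of classes come from tensor products over the fibre product of the two groups, inverses
from dual spaces. The identity comes from $E$ itself, acted on by $\mu_n \rtimes G$ rather than by
$G$ so that the scalars generate; here it matters that a root of unity generates $E$. -/

noncomputable section

/-! ### Restriction along group homomorphisms. -/

section Comap

variable {G : Type u} {R : Type v} [Group G] [CommRing R] [MulSemiringAction G R]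
  {H : Type*} [Group H] [MulSemiringAction H R]

/-- Restriction of a module over a skew group algebra along a group homomorphism. -/
def GModAct.comap {P : Type v} [AddCommGroup P] [Module R P] (σ : GModAct G R P) (f : H →* G)
    (hf : ∀ (h : H) (r : R), f h • r = h • r) : GModAct H R P where
  act := σ.act.comp f
  act_smul h r p := by simp [σ.act_smul, hf]

/-- Restriction of a `G`-algebra along a group homomorphism. -/
def GAlgAct.comap {A : Type v} [Ring A] [Algebra R A] (α : GAlgAct G R A) (f : H →* G)
    (hf : ∀ (h : H) (r : R), f h • r = h • r) : GAlgAct H R A where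
  act := α.act.comp f
  act_algebraMap h r := by simp [α.act_algebraMap, hf]

@[simp] theorem GModAct.comap_act {P : Type v} [AddCommGroup P] [Module R P] (σ : GModAct G R P)
    (f : H →* G) (hf : ∀ (h : H) (r : R), f h • r = h • r) (h : H) (p : P) :
    (σ.comap f hf).act h p = σ.act (f h) p := rfl

@[simp] theorem GAlgAct.comap_act {A : Type v} [Ring A] [Algebra R A] (α : GAlgAct G R A)
    (f : H →* G) (hf : ∀ (h : H) (r : R), f h • r = h • r) (h : H) (a : A) :
    (α.comap f hf).act h a = α.act (f h) a := rfl

theorem GAlgAct.Iso.comap {A B : Type v} [Ring A] [Algebra R A] [Ring B] [Algebra R B]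
    {α : GAlgAct G R A} {β : GAlgAct G R B} (f : H →* G)
    (hf : ∀ (h : H) (r : R), f h • r = h • r) : α.Iso β → (α.comap f hf).Iso (β.comap f hf) := by
  rintro ⟨e, he⟩
  exact ⟨e, fun h a => he (f h) a⟩

end Comap

/-! ### Dual modules and opposite endomorphism algebras. -/

section Dual

variable {G : Type u} {R : Type v} [Group G] [Field R] [MulSemiringAction G R]
  {P : Type v} [AddCommGroup P] [Module R P]

/-- The action of `g` on the dual module, `(g f) p = g (f (g⁻¹ p))`. -/
def GModAct.dualEnd (σ : GModAct G R P) (g : G) : AddMonoid.End (Module.Dual R P) where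
  toFun f :=
    { toFun := fun p => g • f (σ.act g⁻¹ p)
      map_add' := fun p q => by simp
      map_smul' := fun r p => by simp [σ.act_smul] }
  map_zero' := by ext; simp
  map_add' f f' := by ext; simp

theorem GModAct.dualEnd_apply (σ : GModAct G R P) (g : G) (f : Module.Dual R P) (p : P) :
    σ.dualEnd g f p = g • f (σ.act g⁻¹ p) := rfl

/-- The dual module, with `(g f) p = g (f (g⁻¹ p))`. -/
def GModAct.dual (σ : GModAct G R P) : GModAct G R (Module.Dual R P) where
  act :=
    { toFun := σ.dualEnd
      map_one' := by
        ext f p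
        change σ.dualEnd 1 f p = f p
        simp [dualEnd_apply]
      map_mul' := fun g h => by
        ext f p
        change σ.dualEnd (g * h) f p = σ.dualEnd g (σ.dualEnd h f) p
        simp [dualEnd_apply, mul_smul] }
  act_smul g r f := by
    ext p
    change σ.dualEnd g (r • f) p = (g • r) • σ.dualEnd g f p
    simp [dualEnd_apply]

@[simp] theorem GModAct.dual_act_apply (σ : GModAct G R P) (g : G) (f : Module.Dual R P) (p : P) :
    σ.dual.act g f p = g • f (σ.act g⁻¹ p) := rfl

/-- Evaluation embeds $P$ in its bidual, so an endomorphism is determined by its transpose; both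
endomorphism spaces have the same dimension. -/
theorem Module.Dual.transpose_bijective [Module.Finite R P] :
    Function.Bijective (Module.Dual.transpose (R := R) (M := P) (M' := P)) := by
  have hinj : Function.Injective (Module.Dual.transpose (R := R) (M := P) (M' := P)) := by
    intro f g hfg
    ext p
    refine (Module.evalEquiv R P).injective ?_
    ext φ
    exact LinearMap.congr_fun (LinearMap.congr_fun hfg φ) p
  have hrank : Module.finrank R (P →ₗ[R] P) =
      Module.finrank R (Module.Dual R P →ₗ[R] Module.Dual R P) := by
    rw [Module.finrank_linearMap, Module.finrank_linearMap, Subspace.dual_finrank_eq]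
  have h := LinearMap.injective_iff_surjective_of_finrank_eq_finrank (K := R)
    (V := P →ₗ[R] P) (V₂ := Module.Dual R P →ₗ[R] Module.Dual R P) hrank
    (f := Module.Dual.transpose (R := R) (M := P) (M' := P))
  exact ⟨hinj, h.1 hinj⟩

/-- Transposition reverses products and respects conjugation by $G$. This is what lets dual spaces
realize inverse classes. -/
theorem GModAct.endAct_op [Module.Finite R P] (σ : GModAct G R P) :
    σ.endAct.op.Iso σ.dual.endAct := by
  let e : (Module.End R P)ᵐᵒᵖ →ₐ[R] Module.End R (Module.Dual R P) :=
    { toFun := fun f => f.unop.dualMap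
      map_one' := rfl
      map_mul' := fun f g => rfl
      map_zero' := by
        ext φ p
        exact map_zero φ
      map_add' := fun f g => by
        ext φ p
        exact map_add φ _ _
      commutes' := fun r => by
        ext φ p
        exact map_smul φ r p }
  refine ⟨AlgEquiv.ofBijective e
    (Module.Dual.transpose_bijective.comp MulOpposite.unop_bijective), fun g f => ?_⟩
  ext φ p
  change φ (σ.act g (f.unop (σ.act g⁻¹ p))) =
    g • g⁻¹ • φ (σ.act g⁻¹⁻¹ (f.unop (σ.act g⁻¹ p)))
  simp

end Dual

/-! ### Semilinear modules with scalar kernel: products, duals, reduction to cyclic kernel. -/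

/-- A group `H` over `G` acting semilinearly on a finite-dimensional space `V` over the field `R`
in such a way that the kernel of `H → G` acts by scalars. -/
structure ScalarKernelModule (G : Type u) (R : Type) [Group G] [Field R]
    [MulSemiringAction G R] where
  H : Type
  [group : Group H]
  [finite : Finite H]
  [action : MulSemiringAction H R]
  κ : H →* G
  surjective : Function.Surjective κ
  κ_smul : ∀ (h : H) (r : R), κ h • r = h • r
  V : Type
  [addCommGroup : AddCommGroup V]
  [module : Module R V]
  [nontrivial : Nontrivial V]
  [finiteDimensional : FiniteDimensional R V]
  σ : GModAct H R V
  scalar : H → R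
  act_eq : ∀ n ∈ κ.ker, ∀ v, σ.act n v = scalar n • v

namespace ScalarKernelModule

attribute [instance] group finite action addCommGroup module nontrivial finiteDimensional

variable {G : Type u} {R : Type} [Group G] [Field R] [MulSemiringAction G R]

/-- The class `c` is represented by the `G`-algebra `End_R(V)`. -/
def Represents (D : ScalarKernelModule G R) (c : BrCliff G R) : Prop :=
  ∃ A : AzumayaGAlg G R, (A.action.comap D.κ D.κ_smul).Iso D.σ.endAct ∧ c = BrCliff.mk A

variable (D D' : ScalarKernelModule G R)

theorem isProgenerator : IsProgenerator R D.V := ⟨inferInstance, inferInstance, inferInstance⟩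

theorem ker_smul {n : D.H} (hn : n ∈ D.κ.ker) (r : R) : n • r = r := by
  rw [← D.κ_smul, MonoidHom.mem_ker.1 hn, one_smul]

theorem scalar_eq_of_act {n : D.H} (hn : n ∈ D.κ.ker) {r : R}
    (h : ∀ v, D.σ.act n v = r • v) : D.scalar n = r := by
  obtain ⟨v, hv⟩ := exists_ne (0 : D.V)
  exact smul_left_injective R hv ((D.act_eq n hn v).symm.trans (h v))

/-- The scalars by which the kernel acts, as a homomorphism. -/
def scalarHom : D.κ.ker →* R where
  toFun n := D.scalar n
  map_one' := D.scalar_eq_of_act (one_mem _) fun v => by simp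
  map_mul' m n := D.scalar_eq_of_act (mul_mem m.2 n.2) fun v => by
    simp [D.act_eq _ m.2, D.act_eq _ n.2, mul_smul]

/-- By semilinearity, moving a scalar past the action of $h$ applies $h$ to it. This becomes the
equivariance of the linear character of the kernel. -/
theorem scalar_conj (h : D.H) {n : D.H} (hn : n ∈ D.κ.ker) :
    D.scalar (h * n * h⁻¹) = D.κ h • D.scalar n := by
  refine D.scalar_eq_of_act (D.κ.normal_ker.conj_mem n hn h) fun v => ?_
  simp [D.act_eq _ hn, D.σ.act_smul, D.κ_smul]

/-- The scalars by which the kernel acts generate `R` as an `F`-algebra. -/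
def Generates (F : Type) [Field F] [Algebra F R] : Prop :=
  Algebra.adjoin F (D.scalar '' D.κ.ker) = ⊤

/-- The fibre product of the two groups over `G`. -/
abbrev Fibre : Subgroup (D.H × D'.H) :=
  (D.κ.comp (MonoidHom.fst D.H D'.H)).eqLocus (D'.κ.comp (MonoidHom.snd D.H D'.H))

/-- The first projection. -/
abbrev fibreFst : D.Fibre D' →* D.H := (MonoidHom.fst D.H D'.H).comp (D.Fibre D').subtype

/-- The second projection. -/
abbrev fibreSnd : D.Fibre D' →* D'.H := (MonoidHom.snd D.H D'.H).comp (D.Fibre D').subtype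

theorem κ_fibreFst (h : D.Fibre D') : D.κ (D.fibreFst D' h) = D'.κ (D.fibreSnd D' h) := h.2

instance : MulSemiringAction (D.Fibre D') R := MulSemiringAction.compHom R (D.fibreFst D')

theorem fibreFst_smul (h : D.Fibre D') (r : R) : D.fibreFst D' h • r = h • r := rfl

theorem fibreSnd_smul (h : D.Fibre D') (r : R) : D.fibreSnd D' h • r = h • r := by
  rw [← fibreFst_smul, ← D.κ_smul, ← D'.κ_smul, κ_fibreFst]

/-- The tensor product, with the diagonal action of the fibre product. -/
def fibreTensor : GModAct (D.Fibre D') R (D.V ⊗[R] D'.V) :=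
  (D.σ.comap (D.fibreFst D') (D.fibreFst_smul D')).tensor
    (D'.σ.comap (D.fibreSnd D') (D.fibreSnd_smul D'))

/-- The tensor product, with the diagonal action of the fibre product of the two groups. -/
def mul : ScalarKernelModule G R where
  H := D.Fibre D'
  κ := D.κ.comp (D.fibreFst D')
  surjective g := by
    obtain ⟨a, ha⟩ := D.surjective g
    obtain ⟨b, hb⟩ := D'.surjective g
    exact ⟨⟨(a, b), ha.trans hb.symm⟩, ha⟩
  κ_smul h r := D.κ_smul (D.fibreFst D' h) r
  V := D.V ⊗[R] D'.V
  σ := D.fibreTensor D'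
  scalar h := D.scalar (D.fibreFst D' h) * D'.scalar (D.fibreSnd D' h)
  act_eq n hn v := by
    have hn₂ : D.fibreSnd D' n ∈ D'.κ.ker := (D.κ_fibreFst D' n).symm.trans hn
    induction v with
    | zero => simp
    | add x y hx hy => rw [map_add, hx, hy, smul_add]
    | tmul x y =>
      change D.σ.act (D.fibreFst D' n) x ⊗ₜ[R] D'.σ.act (D.fibreSnd D' n) y = _
      rw [D.act_eq _ hn, D'.act_eq _ hn₂, TensorProduct.smul_tmul_smul]

/-- On the fibre product both projections induce the same map to $G$, so the diagonal action of $G$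
on $A \otimes B$ restricts to the tensor product of the two restricted actions. -/
theorem comap_tensor_iso_fibreTensor {D D' : ScalarKernelModule G R} {A B : AzumayaGAlg G R}
    (hA : (A.action.comap D.κ D.κ_smul).Iso D.σ.endAct)
    (hB : (B.action.comap D'.κ D'.κ_smul).Iso D'.σ.endAct)
    (hκ : ∀ (h : D.Fibre D') (r : R), D.κ.comp (D.fibreFst D') h • r = h • r) :
    ((A.action.tensor B.action).comap (D.κ.comp (D.fibreFst D')) hκ).Iso
      (D.fibreTensor D').endAct := by
  have h₁ := hA.comap (D.fibreFst D') (D.fibreFst_smul D')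
  have h₂ := hB.comap (D.fibreSnd D') (D.fibreSnd_smul D')
  have h₃ := GModAct.endAct_tensor D.isProgenerator D'.isProgenerator
    (D.σ.comap (D.fibreFst D') (D.fibreFst_smul D'))
    (D'.σ.comap (D.fibreSnd D') (D.fibreSnd_smul D'))
  have h₄ := (GAlgAct.tensor_congr h₁ h₂).trans h₃
  refine GAlgAct.Iso.trans ?_ h₄
  refine ⟨AlgEquiv.refl, fun h x => ?_⟩
  rw [GAlgAct.comap_act]
  simp only [AlgEquiv.coe_refl, id_eq]
  induction x with
  | zero => rw [map_zero, map_zero]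
  | add x y hx hy => rw [map_add, map_add, hx, hy]
  | tmul a b =>
    simp only [GAlgAct.tensor_tmul, GAlgAct.comap_act, ← D.κ_fibreFst D' h]
    rfl

theorem Represents.mul {D D' : ScalarKernelModule G R} {c c' : BrCliff G R} :
    D.Represents c → D'.Represents c' → (D.mul D').Represents (c * c') := by
  rintro ⟨A, hA, rfl⟩ ⟨B, hB, rfl⟩
  exact ⟨A.tensor B, comap_tensor_iso_fibreTensor hA hB _, BrCliff.mk_mul_mk A B⟩

/-- The elements $(n, 1)$ with $n$ in the first kernel already provide all scalars of the first
factor. -/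
theorem Generates.mul {D : ScalarKernelModule G R} (D' : ScalarKernelModule G R)
    {F : Type} [Field F] [Algebra F R] (h : D.Generates F) : (D.mul D').Generates F := by
  refine top_le_iff.1 (h.symm.le.trans (Algebra.adjoin_mono ?_))
  rintro _ ⟨n, hn, rfl⟩
  refine ⟨⟨(n, 1), ?_⟩, hn, ?_⟩
  · exact (MonoidHom.mem_ker.1 hn).trans (map_one D'.κ).symm
  · change D.scalar n * D'.scalar 1 = _
    rw [show D'.scalar 1 = 1 from D'.scalarHom.map_one, mul_one]

/-- The dual. -/
def dual : ScalarKernelModule G R where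
  H := D.H
  κ := D.κ
  surjective := D.surjective
  κ_smul := D.κ_smul
  V := Module.Dual R D.V
  σ := D.σ.dual
  -- The action on the dual evaluates at $h^{-1} v$; elements of the kernel fix $R$, so no further
  -- twist appears.
  scalar h := D.scalar h⁻¹
  act_eq n hn f := by
    ext v
    simp [D.act_eq _ (inv_mem hn), D.ker_smul hn]

theorem Represents.dual {D : ScalarKernelModule G R} {c : BrCliff G R} :
    D.Represents c → D.dual.Represents c⁻¹ := by
  rintro ⟨A, ⟨e, he⟩, rfl⟩
  refine ⟨A.op, GAlgAct.Iso.trans ?_ D.σ.endAct_op, BrCliff.inv_mk A⟩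
  exact ⟨e.op, fun h a => congrArg MulOpposite.op (he h a.unop)⟩

theorem Generates.dual {D : ScalarKernelModule G R}
    {F : Type} [Field F] [Algebra F R] (h : D.Generates F) : D.dual.Generates F := by
  refine top_le_iff.1 (h.symm.le.trans (Algebra.adjoin_mono ?_))
  rintro _ ⟨n, hn, rfl⟩
  refine ⟨n⁻¹, inv_mem hn, congrArg D.scalar (inv_inv n)⟩

/-- The quotient of `H` by the part of the kernel that acts trivially on `V`. -/
def reduce : ScalarKernelModule G R :=
  let K := (D.κ.prod D.σ.act).ker
  have hK {h : D.H} (hh : h ∈ K) : D.κ h = 1 ∧ D.σ.act h = 1 := by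
    simpa using MonoidHom.mem_ker.1 hh
  let κ' : D.H ⧸ K →* G := QuotientGroup.lift K D.κ fun _ hh => (hK hh).1
  letI : MulSemiringAction (D.H ⧸ K) R := MulSemiringAction.compHom R κ'
  { H := D.H ⧸ K
    κ := κ'
    surjective := fun g => by
      obtain ⟨h, rfl⟩ := D.surjective g
      exact ⟨h, rfl⟩
    κ_smul := fun _ _ => rfl
    V := D.V
    σ :=
      { act := QuotientGroup.lift K D.σ.act fun _ hh => (hK hh).2
        act_smul := fun h r v => by
          obtain ⟨h, rfl⟩ := QuotientGroup.mk_surjective h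
          exact (D.σ.act_smul h r v).trans (by rw [← D.κ_smul]; rfl) }
    -- The choice of representative is harmless on the kernel: any two differ by an element acting
    -- trivially on $V$.
    scalar := fun x => D.scalar x.out
    act_eq := fun n hn v => by
      have h : ((n.out : D.H) : D.H ⧸ K) = n := QuotientGroup.out_eq' n
      conv_lhs => rw [← h]
      refine D.act_eq _ ?_ v
      rw [← h] at hn
      exact hn }

theorem Represents.reduce {D : ScalarKernelModule G R} {c : BrCliff G R} :
    D.Represents c → D.reduce.Represents c := by
  rintro ⟨A, ⟨e, he⟩, rfl⟩
  refine ⟨A, ⟨e, fun h a => ?_⟩, rfl⟩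
  obtain ⟨h, rfl⟩ := QuotientGroup.mk_surjective h
  exact he h a

theorem Generates.reduce {D : ScalarKernelModule G R}
    {F : Type} [Field F] [Algebra F R] (h : D.Generates F) : D.reduce.Generates F := by
  refine top_le_iff.1 (h.symm.le.trans (Algebra.adjoin_mono ?_))
  rintro _ ⟨n, hn, rfl⟩
  exact ⟨QuotientGroup.mk n, hn, D.reduce.scalar_eq_of_act hn (D.act_eq n hn)⟩

/-- After the reduction, a kernel element with scalar $1$ is trivial. Thus the finite kernel embeds
in the multiplicative group of a field. -/
theorem isCyclic_ker_reduce : IsCyclic D.reduce.κ.ker := by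
  refine isCyclic_of_injective_ringHom D.reduce.scalarHom ?_
  refine (injective_iff_map_eq_one _).2 ?_
  rintro ⟨n, hn⟩ h1
  have hv (v) := D.reduce.act_eq n hn v
  rw [show D.reduce.scalar n = 1 from h1] at hv
  ext
  obtain ⟨n, rfl⟩ := QuotientGroup.mk_surjective n
  refine (QuotientGroup.eq_one_iff n).2 (MonoidHom.mem_ker.2 (Prod.ext hn ?_))
  ext v
  exact (hv v).trans (one_smul R v)

end ScalarKernelModule

/-! ### The identity class, and the subgroup of represented classes. -/

namespace ScalarKernelModule

variable {G : Type u} {R : Type} [Group G] [Field R] [MulSemiringAction G R]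

/-- A copy of the finite group `G` in `Type` acts on `R`. -/
instance [Finite G] : MulSemiringAction (Shrink.{0} G) R :=
  MulSemiringAction.compHom R (Shrink.mulEquiv.{0} (α := G)).toMonoidHom

section RootsOfUnity

variable (G R) [Finite G] (n : ℕ)

/-- The action of `G` on the `n`-th roots of unity of `R`. -/
def rootsOfUnityAut : Shrink.{0} G →* MulAut (rootsOfUnity n R) where
  toFun g := (MulSemiringAction.toRingEquiv (Shrink.{0} G) R g).toMulEquiv.restrictRootsOfUnity n
  map_one' := by
    ext x
    exact one_smul (Shrink.{0} G) ((x : Rˣ) : R)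
  map_mul' g h := by
    ext x
    exact mul_smul g h ((x : Rˣ) : R)

/-- The semidirect product of the group of `n`-th roots of unity by `G`. -/
abbrev RootsOfUnityExt : Type := rootsOfUnity n R ⋊[rootsOfUnityAut G R n] Shrink.{0} G

/-- The projection onto `G`. -/
def rootsOfUnityProj : RootsOfUnityExt G R n →* G :=
  (Shrink.mulEquiv.{0} (α := G)).toMonoidHom.comp SemidirectProduct.rightHom

instance : MulSemiringAction (RootsOfUnityExt G R n) R :=
  MulSemiringAction.compHom R (rootsOfUnityProj G R n)

instance [NeZero n] : Finite (RootsOfUnityExt G R n) := Finite.of_equiv _ SemidirectProduct.equivProd.symm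

/-- The semidirect product of the roots of unity by `G` acts on `R`. -/
def rootsOfUnityModule : GModAct (RootsOfUnityExt G R n) R R where
  act :=
    { toFun := fun h =>
        { toFun := fun r => ((h.left : Rˣ) : R) * h.right • r
          map_zero' := by simp
          map_add' := fun r s => by rw [smul_add, mul_add] }
      map_one' := by
        ext r
        change (((1 : RootsOfUnityExt G R n).left : Rˣ) : R) *
          (1 : RootsOfUnityExt G R n).right • r = r
        simp
      map_mul' := fun h k => by
        ext r
        change (((h * k).left : Rˣ) : R) * (h * k).right • r =
          ((h.left : Rˣ) : R) * h.right • (((k.left : Rˣ) : R) * k.right • r)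
        rw [smul_mul', ← mul_assoc, ← mul_smul]
        rfl }
  act_smul h r p := by
    change ((h.left : Rˣ) : R) * h.right • (r * p) =
      (h.right • r) * (((h.left : Rˣ) : R) * h.right • p)
    rw [smul_mul']
    ring

theorem rootsOfUnityModule_act (h : RootsOfUnityExt G R n) (r : R) :
    (rootsOfUnityModule G R n).act h r = ((h.left : Rˣ) : R) * h.right • r := rfl

/-- The field `R`, acted upon by `G` and the `n`-th roots of unity. -/
def rootsOfUnityUnit [NeZero n] : ScalarKernelModule G R where
  H := RootsOfUnityExt G R n
  κ := rootsOfUnityProj G R n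
  surjective g := ⟨SemidirectProduct.inr ((Shrink.mulEquiv.{0} (α := G)).symm g), by
    simp [rootsOfUnityProj]⟩
  κ_smul _ _ := rfl
  V := R
  σ := rootsOfUnityModule G R n
  scalar h := ((h.left : Rˣ) : R)
  act_eq h hh v := by
    have h1 : h.right = 1 := by simpa [rootsOfUnityProj] using hh
    rw [rootsOfUnityModule_act, h1, one_smul, smul_eq_mul]

/-- Conjugating multiplication by $r$ with the semilinear map $\zeta g$ gives multiplication by $g
r$: the root of unity cancels. -/
theorem represents_rootsOfUnityUnit [NeZero n] : (rootsOfUnityUnit G R n).Represents 1 := by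
  refine ⟨AzumayaGAlg.unit G R, ?_, BrCliff.one_def⟩
  obtain ⟨e, -⟩ := GAlgAct.endAct_unit (G := G) (R := R)
  refine ⟨e, fun (h : RootsOfUnityExt G R n) (r : R) => ?_⟩
  have he (r p : R) : e r p = r * p := by
    have := e.commutes r
    change e r = _ at this
    rw [this]
    simp [Module.algebraMap_end_apply]
  ext
  change e ((rootsOfUnityProj G R n h) • r) 1 = (rootsOfUnityModule G R n).act h
    (e r ((rootsOfUnityModule G R n).act h⁻¹ 1))
  have hr (s : R) : (rootsOfUnityModule G R n).act h (r * s) =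
      (rootsOfUnityProj G R n h • r) * (rootsOfUnityModule G R n).act h s :=
    (rootsOfUnityModule G R n).act_smul h r s
  rw [he, he, hr, GModAct.act_act_inv]

theorem generates_rootsOfUnityUnit [NeZero n] {F : Type} [Field F] [Algebra F R] {x : R} (hx : x ^ n = 1)
    (hgen : Algebra.adjoin F {x} = ⊤) : (rootsOfUnityUnit G R n).Generates F := by
  refine top_le_iff.1 (hgen.symm.le.trans (Algebra.adjoin_mono ?_))
  rw [Set.singleton_subset_iff]
  have h : rootsOfUnityProj G R n (SemidirectProduct.inl (rootsOfUnity.mkOfPowEq x hx)) = 1 := by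
    simp [rootsOfUnityProj]
  exact ⟨_, MonoidHom.mem_ker.2 h, rfl⟩

end RootsOfUnity

/-- The classes represented by modules such that the scalars generate `R` over `F` form a
subgroup, provided that `R` is generated by a root of unity. -/
def subgroup [Finite G] (F : Type) [Field F] [Algebra F R] {x : R} (hx : IsOfFinOrder x)
    (hgen : Algebra.adjoin F {x} = ⊤) : Subgroup (BrCliff G R) where
  carrier := {c | ∃ D : ScalarKernelModule G R, D.Represents c ∧ D.Generates F}
  one_mem' := by
    -- With $n$ the order of $x$, the generator $x$ is itself one of the scalars of $\mu_n \rtimes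
    -- G$.
    have : NeZero (orderOf x) := ⟨hx.orderOf_pos.ne'⟩
    exact ⟨_, represents_rootsOfUnityUnit G R (orderOf x),
      generates_rootsOfUnityUnit G R _ (pow_orderOf_eq_one x) hgen⟩
  mul_mem' := by
    rintro _ _ ⟨D, hD, hF⟩ ⟨D', hD', -⟩
    exact ⟨_, hD.mul hD', hF.mul D'⟩
  inv_mem' := by
    rintro _ ⟨D, hD, hF⟩
    exact ⟨_, hD.dual, hF.dual⟩

end ScalarKernelModule

/-! ### From pairs with abelian kernel to modules with scalar kernel. -/

namespace CliffordPair

variable {G : Type u} [Group G] (P : CliffordPair G) {F : Subfield ℂ}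

section Representation

variable {V : Type} [AddCommGroup V] [Module F V] (ρ : Representation F P.Ghat V)

theorem actFN_single (n : P.N) (c : F) : P.actFN ρ (MonoidAlgebra.single n c) = c • ρ n := by
  simp [actFN, Representation.asAlgebraHom_single]

theorem mul_actFN (g : P.Ghat) (x : P.FN F) :
    ρ g * P.actFN ρ x = P.actFN ρ (P.conjFN F g x) * ρ g := by
  induction x using MonoidAlgebra.induction_linear with
  | zero => simp
  | add x y hx hy => simp only [map_add, mul_add, add_mul, hx, hy]
  | single n c =>
    have h : P.conjFN F g (MonoidAlgebra.single n c) =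
        MonoidAlgebra.single (MulAut.conjNormal g n) c := by simp [conjFN]
    rw [h, actFN_single, actFN_single, mul_smul_comm, smul_mul_assoc, ← map_mul, ← map_mul]
    simp

end Representation

variable {P}

theorem mem_center_of_comm (hN : ∀ m n : P.κ.ker, m * n = n * m) (x : P.FN F) :
    x ∈ Subalgebra.center F (P.FN F) := by
  rw [Subalgebra.mem_center_iff]
  intro y
  induction x using MonoidAlgebra.induction_linear with
  | zero => simp
  | add x x' hx hx' => rw [add_mul, mul_add, hx, hx']
  | single n c =>
    induction y using MonoidAlgebra.induction_linear with
    | zero => simp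
    | add y y' hy hy' => rw [add_mul, mul_add, hy, hy']
    | single m d => rw [MonoidAlgebra.single_mul_single, MonoidAlgebra.single_mul_single, hN,
        mul_comm]

theorem mul_mem_centerAlgebra (hN : ∀ m n : P.κ.ker, m * n = n * m) (x : P.FN F)
    {y : P.FN F} (hy : y ∈ P.centerAlgebra F) : x * y ∈ P.centerAlgebra F := by
  obtain ⟨z, -, rfl⟩ := hy
  exact ⟨x * z, mem_center_of_comm hN _, (mul_assoc x z _).symm⟩

namespace CenterIso

variable {R : Type} [Field R] [Algebra F R] [MulSemiringAction G R] (α : P.CenterIso F R)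

theorem map_smul' (c : F) (z : P.centerAlgebra F) :
    α.toRingEquiv (c • z) = c • α.toRingEquiv z := α.map_smul c z

theorem map_conj' (g : P.Ghat) (z : P.centerAlgebra F) :
    α.toRingEquiv (P.conjZ F g z) = P.κ g • α.toRingEquiv z := α.map_conj g z

/-- The preimage of `1`. -/
def one : P.centerAlgebra F := α.toRingEquiv.symm 1

theorem mul_one (z : P.centerAlgebra F) : z * α.one = z :=
  α.toRingEquiv.injective (by rw [map_mul, one, RingEquiv.apply_symm_apply, _root_.mul_one])

/-- For abelian `N`, the isomorphism `α`, extended to the group algebra. -/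
def extend (hN : ∀ m n : P.κ.ker, m * n = n * m) : P.FN F →ₗ[F] R where
  toFun x := α.toRingEquiv ⟨x * α.one, mul_mem_centerAlgebra hN x α.one.2⟩
  map_add' x y := by
    rw [← map_add]
    exact congrArg _ (Subtype.ext (add_mul _ _ _))
  map_smul' c x := by
    rw [RingHom.id_apply, ← map_smul']
    exact congrArg _ (Subtype.ext (smul_mul_assoc _ _ _))

theorem extend_coe (hN : ∀ m n : P.κ.ker, m * n = n * m) (z : P.centerAlgebra F) :
    α.extend hN z = α.toRingEquiv z :=
  congrArg α.toRingEquiv (α.mul_one z)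

/-- The group elements span $FN$, and the $F$-linear extension of $\alpha$ is onto since it agrees
with $\alpha$ on the center algebra. -/
theorem adjoin_extend (hN : ∀ m n : P.κ.ker, m * n = n * m) :
    Algebra.adjoin F (Set.range fun n : P.N => α.extend hN (MonoidAlgebra.single n 1)) = ⊤ := by
  have h (x : P.FN F) : α.extend hN x ∈
      Algebra.adjoin F (Set.range fun n : P.N => α.extend hN (MonoidAlgebra.single n 1)) := by
    induction x using MonoidAlgebra.induction_linear with
    | zero => rw [map_zero]; exact zero_mem _
    | add x y hx hy => rw [map_add]; exact add_mem hx hy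
    | single n c =>
      rw [← _root_.mul_one c, ← smul_eq_mul, ← MonoidAlgebra.smul_single, _root_.map_smul]
      exact Subalgebra.smul_mem _ (Algebra.subset_adjoin (Set.mem_range_self n)) c
  refine top_le_iff.1 fun r _ => ?_
  obtain ⟨z, rfl⟩ := α.toRingEquiv.surjective r
  exact α.extend_coe hN z ▸ h z

variable {V : Type} [AddCommGroup V] [Module F V] {ρ : Representation F P.Ghat V}

/-- The preimage of $1$ is a unit for the center algebra, so it absorbs into $(e_{\theta,F})^G$,
which acts as the identity. -/
theorem actFN_one (hρ : P.IsQuasihomogeneous ρ) : P.actFN ρ α.one = 1 := by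
  have h : P.eG F ∈ P.centerAlgebra F := ⟨1, one_mem _, (one_mul _).symm⟩
  have h2 : P.eG F * α.one = P.eG F := 
    congrArg Subtype.val (α.mul_one (⟨_, h⟩ : P.centerAlgebra F))
  have h3 := congrArg (P.actFN ρ) h2
  rwa [map_mul, hρ.eG_act, one_mul] at h3

/-- The action of `R` on a quasihomogeneous module. -/
def toEnd (hρ : P.IsQuasihomogeneous ρ) : R →+* Module.End F V where
  toFun r := P.actFN ρ (α.toRingEquiv.symm r)
  map_one' := α.actFN_one hρ
  map_mul' r s := by rw [map_mul]; exact map_mul (P.actFN ρ) _ _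
  map_zero' := by rw [map_zero]; exact map_zero (P.actFN ρ)
  map_add' r s := by rw [map_add]; exact map_add (P.actFN ρ) _ _

theorem toEnd_apply (hρ : P.IsQuasihomogeneous ρ) (z : P.centerAlgebra F) :
    α.toEnd hρ (α.toRingEquiv z) = P.actFN ρ z :=
  congrArg (fun w : P.centerAlgebra F => P.actFN ρ w) (α.toRingEquiv.symm_apply_apply z)

theorem toEnd_smul (hρ : P.IsQuasihomogeneous ρ) (c : F) (r : R) :
    α.toEnd hρ (c • r) = c • α.toEnd hρ r := by
  obtain ⟨z, rfl⟩ := α.toRingEquiv.surjective r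
  rw [← α.map_smul', toEnd_apply, toEnd_apply]
  exact _root_.map_smul (P.actFN ρ) c (z : P.FN F)

theorem toEnd_extend_single (hN : ∀ m n : P.κ.ker, m * n = n * m)
    (hρ : P.IsQuasihomogeneous ρ) (n : P.N) :
    α.toEnd hρ (α.extend hN (MonoidAlgebra.single n 1)) = ρ n := by
  refine (α.toEnd_apply hρ _).trans ?_
  rw [map_mul, actFN_one α hρ, actFN_single, one_smul, _root_.mul_one]

theorem mul_toEnd (hρ : P.IsQuasihomogeneous ρ) (g : P.Ghat) (r : R) :
    ρ g * α.toEnd hρ r = α.toEnd hρ (P.κ g • r) * ρ g := by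
  obtain ⟨z, rfl⟩ := α.toRingEquiv.surjective r
  rw [← α.map_conj', toEnd_apply, toEnd_apply]
  exact P.mul_actFN ρ g z

/-- A quasihomogeneous module for a pair with abelian kernel, as a semilinear representation on
which the kernel acts by scalars. -/
theorem exists_scalarKernelModule (hN : ∀ m n : P.κ.ker, m * n = n * m) {c : BrCliff G R}
    (hc : P.IsBrCliffClass α c) :
    ∃ D : ScalarKernelModule G R, D.Represents c ∧ D.Generates F := by
  obtain ⟨V, _, _, ρ, A, hρ, ⟨φ, hφ, hφ'⟩, rfl⟩ := hc
  let _ : MulSemiringAction P.Ghat R := MulSemiringAction.compHom R P.κ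
  -- The center algebra, identified with $R$ by $\alpha$, turns $V$ into an $R$-space.
  let _ : Module R V := Module.compHom V (α.toEnd hρ)
  have hsmul (r : R) (v : V) : r • v = α.toEnd hρ r v := rfl
  have _ : IsScalarTower F R V := ⟨fun c r v => by
    rw [hsmul, hsmul, toEnd_smul, LinearMap.smul_apply]⟩
  have _ := hρ.nontrivial
  have _ := hρ.finite
  have _ : Module.Finite R V := Module.Finite.of_restrictScalars_finite F R V
  let l : P.N → R := fun n => α.extend hN (MonoidAlgebra.single n 1)
  have hl (n : P.N) (v : V) : ρ n v = l n • v := by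
    rw [hsmul, toEnd_extend_single]
  let σ : GModAct P.Ghat R V :=
    { act :=
        { toFun := fun g => (ρ g).toAddMonoidHom
          map_one' := by rw [map_one]; rfl
          map_mul' := fun g h => by rw [map_mul]; rfl }
      act_smul := fun g r v => LinearMap.congr_fun (α.mul_toEnd hρ g r) v }
  let D : ScalarKernelModule G R :=
    { H := P.Ghat
      κ := P.κ
      surjective := P.surjective
      κ_smul := fun _ _ => rfl
      V := V
      σ := σ
      -- Only values on the kernel matter; the default $0$ elsewhere is arbitrary.
      scalar := Function.extend Subtype.val l 0
      act_eq := fun n hn v => by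
        rw [Subtype.val_injective.extend_apply l 0 ⟨n, hn⟩]
        exact hl ⟨n, hn⟩ v }
  -- Each $\varphi(a)$ is $R$-linear because $R$ is central in $A$ and acts on $V$ through the
  -- center algebra.
  have hφc (a : A.carrier) (r : R) (v : V) :
      (φ a : Module.End F V) (r • v) = r • (φ a : Module.End F V) v := by
    have h := congrArg (fun x : P.endFN ρ => (x : Module.End F V) v)
      (congrArg φ (Algebra.commutes r a))
    obtain ⟨z, rfl⟩ := α.toRingEquiv.surjective r
    rw [hsmul, hsmul, toEnd_apply, ← hφ z]
    simpa using h.symm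
  let f : A.carrier →ₐ[R] Module.End R V :=
    { toFun := fun a =>
        { toFun := (φ a : Module.End F V)
          map_add' := map_add _
          map_smul' := hφc a }
      map_one' := by ext v; simp
      map_mul' := fun a b => by ext v; simp
      map_zero' := by ext v; simp
      map_add' := fun a b => by ext v; simp
      commutes' := fun r => by
        ext v
        obtain ⟨z, rfl⟩ := α.toRingEquiv.surjective r
        refine (LinearMap.congr_fun (hφ z) v).trans ?_
        rw [Module.algebraMap_end_apply, hsmul, toEnd_apply] }
  have hf : Function.Bijective f := by
    refine ⟨fun a b hab => φ.injective (Subtype.ext (LinearMap.ext fun v =>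
      LinearMap.congr_fun hab v)), fun ψ => ?_⟩
    -- An $R$-linear map commutes with $N$ since $N$ acts by scalars from $R$.
    have hψ : ψ.restrictScalars F ∈ P.endFN ρ := by
      refine Subalgebra.mem_centralizer_iff F |>.2 ?_
      rintro _ ⟨n, rfl⟩
      ext v
      change ρ n (ψ v) = ψ (ρ n v)
      rw [hl, hl, ψ.map_smul]
    refine ⟨φ.symm ⟨_, hψ⟩, ?_⟩
    ext v
    change (φ (φ.symm _) : Module.End F V) v = ψ v
    rw [RingEquiv.apply_symm_apply]
    rfl
  refine ⟨D, ⟨A, ⟨AlgEquiv.ofBijective f hf, fun g a => ?_⟩, rfl⟩, ?_⟩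
  · ext v
    exact LinearMap.congr_fun (hφ' g a) v
  · refine top_le_iff.1 ((α.adjoin_extend hN).symm.le.trans (Algebra.adjoin_mono ?_))
    rintro _ ⟨n, rfl⟩
    exact ⟨n, n.2, Subtype.val_injective.extend_apply l 0 n⟩

end CenterIso

end CliffordPair

/-! ### Linear characters: from modules with scalar kernel back to Clifford pairs. -/

/-- The one-dimensional representation attached to a homomorphism into `ℂ`. -/
def scalarRepresentation {N : Type} [Group N] (χ : N →* ℂ) : Representation ℂ N ℂ :=
  (algebraMap ℂ (Module.End ℂ ℂ) : ℂ →* Module.End ℂ ℂ).comp χ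

theorem isIrrChar_of_monoidHom {N : Type} [Group N] (χ : N →* ℂ) : IsIrrChar χ := by
  refine ⟨ℂ, inferInstance, inferInstance, inferInstance, scalarRepresentation χ, ?_, ?_⟩
  · have _ : Nontrivial (Subrepresentation (scalarRepresentation χ)) :=
      ⟨⊥, ⊤, fun h => bot_ne_top (congrArg Subrepresentation.toSubmodule h)⟩
    exact ⟨fun W => (eq_bot_or_eq_top W.toSubmodule).imp
      (fun h => Subrepresentation.toSubmodule_injective h)
      (fun h => Subrepresentation.toSubmodule_injective h)⟩
  · ext n
    simp [Representation.character, scalarRepresentation, Module.algebraMap_end_eq_smul_id,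
      map_smul, LinearMap.trace_id]

theorem trace_eq_of_intermediateField_eq {F L : Type*} [Field F] [Field L] [Algebra F L]
    {K E : IntermediateField F L} (h : K = E) (x : K) :
    Algebra.trace F K x = Algebra.trace F E ⟨x, h ▸ x.2⟩ := by
  subst h
  rfl

namespace CliffordPair

variable {G : Type u} [Group G] {F : Subfield ℂ} {E : IntermediateField F ℂ}

/-- The character `θ` is linear, given by the homomorphism `l` with values in `E`; moreover `l` is
equivariant and its values generate `E`. -/
structure IsLinear [MulSemiringAction G E] (P : CliffordPair G) (l : P.N →* E) : Prop where
  θ_eq : ∀ n, P.θ n = (l n : ℂ)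
  adjoin_range : Algebra.adjoin F (Set.range l) = ⊤
  map_conj : ∀ (g : P.Ghat) (n : P.N), l (MulAut.conjNormal g n) = P.κ g • l n

/-- The linear extension of `l` to the group algebra of the kernel. -/
def lift {P : CliffordPair G} (l : P.N →* E) : P.FN F →ₐ[F] E := MonoidAlgebra.lift F E P.N l

theorem lift_single {P : CliffordPair G} (l : P.N →* E) (n : P.N) (c : F) :
    lift l (MonoidAlgebra.single n c) = c • l n := by
  simp [lift]

namespace IsLinear

variable [MulSemiringAction G E] {P : CliffordPair G} {l : P.N →* E}

theorem lift_surjective (h : P.IsLinear l) :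
    Function.Surjective (lift l) := by
  rw [← AlgHom.range_eq_top, ← top_le_iff, ← h.adjoin_range, Algebra.adjoin_le_iff]
  rintro _ ⟨n, rfl⟩
  exact ⟨MonoidAlgebra.single n 1, (lift_single l n 1).trans (one_smul F _)⟩

theorem fieldOfValues_eq (h : P.IsLinear l) :
    P.fieldOfValues F = E := by
  refine le_antisymm (IntermediateField.adjoin_le_iff.2 ?_) fun x hx => ?_
  · rintro _ ⟨n, rfl⟩
    rw [h.θ_eq]
    exact (l n).2
  · have hle : Algebra.adjoin F (Set.range l) ≤
        (P.fieldOfValues F).toSubalgebra.comap E.val := by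
      rw [Algebra.adjoin_le_iff]
      rintro _ ⟨n, rfl⟩
      change ((l n : E) : ℂ) ∈ P.fieldOfValues F
      exact h.θ_eq n ▸ P.θ_mem F n
    rw [h.adjoin_range] at hle
    exact hle (Algebra.mem_top (x := (⟨x, hx⟩ : E)))

theorem isGalois (h : P.IsLinear l) : IsGalois F E ∧ FiniteDimensional F E := by
  have h1 := P.isAbelianGalois_fieldOfValues F
  rw [h.fieldOfValues_eq] at h1
  obtain ⟨_, h2⟩ := h1
  exact ⟨inferInstance, h2⟩

theorem eF_coeff (h : P.IsLinear l) (n : P.N) :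
    (P.eF F).coeff n =
      Algebra.trace F E ((Nat.card P.N : E)⁻¹ * l n⁻¹) := by
  have := Fintype.ofFinite P.N
  have h1 : (P.eF F).coeff n =
      Algebra.trace F _ (P.eCoeff F n) := by
    rw [CliffordPair.eF, finsum_eq_sum_of_fintype]
    classical
    simp [Finsupp.single_apply]
  rw [h1, trace_eq_of_intermediateField_eq h.fieldOfValues_eq]
  congr 1
  ext
  change P.θ 1 / (Nat.card P.N : ℂ) * P.θ n⁻¹ = _
  rw [h.θ_eq, h.θ_eq, map_one]
  simp

/-- The product $x\, e_{\theta,F}$ depends on $x$ only through its image in $E$. In particular the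
kernel of `lift l` is annihilated by $e_{\theta,F}$. -/
theorem mul_eF_coeff (h : P.IsLinear l) (x : P.FN F)
    (m : P.N) :
    (x * P.eF F).coeff m =
      Algebra.trace F E ((Nat.card P.N : E)⁻¹ * l m⁻¹ * lift l x) := by
  induction x using MonoidAlgebra.induction_linear with
  | zero => simp
  | add x y hx hy => rw [add_mul, MonoidAlgebra.coeff_add, Finsupp.add_apply, hx, hy, map_add,
      mul_add, map_add]
  | single n c =>
    rw [MonoidAlgebra.coeff_single_mul_apply, h.eF_coeff, lift_single, mul_smul_comm,
      map_smul, smul_eq_mul]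
    congr 2
    rw [mul_assoc, ← map_mul]
    congr 2
    group

/-- Expanding traces into Galois conjugates gives the sums $|N|^{-1} \sum_n s(l(n^{-1}))\, l(n)$
over $s \in \mathrm{Gal}(E/F)$. By orthogonality only those with $s \circ l = l$ survive, and $l$
generates $E$, so only $s = 1$ remains. -/
theorem lift_eF (h : P.IsLinear l) :
    lift l (P.eF F) = 1 := by
  obtain ⟨_, _⟩ := h.isGalois
  have := Fintype.ofFinite P.N
  have hcard : (Nat.card P.N : E) ≠ 0 := Nat.cast_ne_zero.2 Nat.card_pos.ne'
  let χ (s : E ≃ₐ[F] E) : P.N →* E :=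
    { toFun := fun n => s (l n⁻¹) * l n
      map_one' := by simp
      map_mul' := fun m n => by
        rw [mul_inv_rev, map_mul, map_mul, map_mul]
        ring }
  have hχ (s : E ≃ₐ[F] E) : χ s = 1 ↔ s = 1 := by
    refine ⟨fun hs => ?_, ?_⟩
    · refine AlgEquiv.coe_toAlgHom_injective (AlgHom.ext_of_adjoin_eq_top h.adjoin_range ?_)
      rintro _ ⟨n, rfl⟩
      have h1 : s (l n⁻¹⁻¹) * l n⁻¹ = 1 := DFunLike.congr_fun hs n⁻¹
      have h2 : l n * l n⁻¹ = 1 := by rw [← map_mul]; simp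
      rw [inv_inv] at h1
      exact mul_right_cancel₀ (right_ne_zero_of_mul_eq_one h2) (h1.trans h2.symm)
    · rintro rfl
      ext n
      change (((l n⁻¹ * l n : E)) : ℂ) = _
      rw [← map_mul]
      simp
  classical
  have hsum : P.eF F =
      ∑ n, MonoidAlgebra.single n ((P.eF F).coeff n) := by
    ext n
    simp
  rw [hsum, map_sum]
  simp_rw [lift_single, h.eF_coeff, Algebra.smul_def, trace_eq_sum_automorphisms]
  simp_rw [Finset.sum_mul]
  rw [Finset.sum_comm]
  have hterm (s : E ≃ₐ[F] E) :
      ∑ n : P.N, s ((Nat.card P.N : E)⁻¹ * l n⁻¹) * l n =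
        if s = 1 then 1 else 0 := by
    have h1 (n : P.N) :
        s ((Nat.card P.N : E)⁻¹ * l n⁻¹) * l n =
          (Nat.card P.N : E)⁻¹ * χ s n := by
      rw [map_mul, map_inv₀, map_natCast, mul_assoc]
      rfl
    simp_rw [h1]
    rw [← Finset.mul_sum, sum_hom_units, ← Nat.card_eq_fintype_card]
    by_cases hs : s = 1
    · rw [if_pos ((hχ s).2 hs), if_pos hs]
      exact inv_mul_cancel₀ hcard
    · rw [if_neg (mt (hχ s).1 hs), if_neg hs]
      simp
  simp_rw [hterm]
  simp

theorem lift_conjFN (h : P.IsLinear l)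
    (hF : ∀ (g : G) (x : F), g • algebraMap F E x = algebraMap F E x)
    (g : P.Ghat) (x : P.FN F) :
    lift l (P.conjFN F g x) = P.κ g • lift l x := by
  induction x using MonoidAlgebra.induction_linear with
  | zero => simp
  | add x y hx hy => rw [map_add, map_add, map_add, hx, hy, smul_add]
  | single n c =>
    have hs : P.conjFN F g (MonoidAlgebra.single n c) =
        MonoidAlgebra.single (MulAut.conjNormal g n) c := by simp [CliffordPair.conjFN]
    rw [hs, lift_single, lift_single, Algebra.smul_def, Algebra.smul_def, smul_mul', hF]
    exact congrArg _ (h.map_conj g n)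

/-- Conjugation by $g$ changes $l$ by the $F$-automorphism of $E$ that $g$ induces, and the
coefficients of $e_{\theta,F}$ are traces to $F$, which do not see it. -/
theorem isSemiInvariant (h : P.IsLinear l)
    (hF : ∀ (g : G) (x : F), g • algebraMap F E x = algebraMap F E x) :
    P.IsSemiInvariant F := by
  intro g
  ext n
  let s : E ≃ₐ[F] E := AlgEquiv.ofRingEquiv
    (f := MulSemiringAction.toRingEquiv G E (P.κ g)) (hF (P.κ g))
  have h1 : (P.conjFN F g (P.eF F)).coeff n =
      (P.eF F).coeff (MulAut.conjNormal g⁻¹ n) := by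
    simp [CliffordPair.conjFN]
  rw [h1, h.eF_coeff, h.eF_coeff]
  rw [← Algebra.trace_eq_of_algEquiv s ((Nat.card P.N : E)⁻¹ * l _)]
  congr 1
  rw [map_mul, map_inv₀, map_natCast]
  refine congrArg (fun y => Algebra.trace F E ((Nat.card P.N : E)⁻¹ * y))
    ((h.map_conj g _).symm.trans (congrArg l ?_))
  simp

theorem eG_eq (h : P.IsLinear l)
    (hF : ∀ (g : G) (x : F), g • algebraMap F E x = algebraMap F E x) :
    P.eG F = P.eF F := by
  have h1 : Set.range (fun g => P.conjFN F g (P.eF F)) =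
      {P.eF F} := by
    simp_rw [h.isSemiInvariant hF _]
    exact Set.range_const
  rw [CliffordPair.eG, h1, finsum_mem_singleton]

/-- Surjectivity: $x\, e_{\theta,F}$ has the same image as $x$. Injectivity: an element of the
center algebra with image $0$ has all coefficients zero by `mul_eF_coeff`. -/
theorem lift_centerAlgebra_bijective (h : P.IsLinear l)
    (hF : ∀ (g : G) (x : F), g • algebraMap F E x = algebraMap F E x)
    (hN : ∀ m n : P.N, m * n = n * m) :
    Function.Bijective ((lift l : P.FN F →ₙ+* E).comp
      (NonUnitalSubalgebraClass.subtype (P.centerAlgebra F) :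
        P.centerAlgebra F →ₙ+* P.FN F)) := by
  refine ⟨(injective_iff_map_eq_zero _).2 ?_, fun r => ?_⟩
  · rintro ⟨_, z, hz, rfl⟩ h0
    have h1 : lift l (z * P.eG F) = 0 := h0
    rw [h.eG_eq hF, map_mul, h.lift_eF, mul_one] at h1
    refine Subtype.ext (MonoidAlgebra.ext (Finsupp.ext fun m => ?_))
    change (z * P.eG F).coeff m = 0
    rw [h.eG_eq hF, h.mul_eF_coeff, h1, mul_zero, map_zero]
  · obtain ⟨x, rfl⟩ := h.lift_surjective r
    refine ⟨⟨x * P.eG F, x, CliffordPair.mem_center_of_comm hN x, rfl⟩, ?_⟩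
    change lift l (x * P.eG F) = _
    rw [h.eG_eq hF, map_mul, h.lift_eF, mul_one]

/-- The isomorphism of the center algebra onto `E` given by the scalars. -/
def centerIso (h : P.IsLinear l)
    (hF : ∀ (g : G) (x : F), g • algebraMap F E x = algebraMap F E x)
    (hN : ∀ m n : P.N, m * n = n * m) : P.CenterIso F E where
  toRingEquiv := RingEquiv.ofBijective _ (h.lift_centerAlgebra_bijective hF hN)
  map_smul c z := _root_.map_smul (lift l) c (z : P.FN F)
  map_conj g z := h.lift_conjFN hF g z

/-- The class of a module on which the kernel acts by the scalars given by `l`. -/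
theorem isBrCliffClass (h : P.IsLinear l)
    (hF : ∀ (g : G) (x : F), g • algebraMap F E x = algebraMap F E x)
    (hN : ∀ m n : P.N, m * n = n * m) {V : Type} [AddCommGroup V] [Module E V] [Module F V]
    [IsScalarTower F E V] [Nontrivial V] [FiniteDimensional E V] (ρ : Representation F P.Ghat V)
    (hρ : ∀ (n : P.N) (v : V), ρ n v = l n • v) (A : AzumayaGAlg G E)
    (e : A.carrier ≃ₐ[E] Module.End E V)
    (he : ∀ (g : P.Ghat) (a : A.carrier) (v : V),
      e (A.action.act (P.κ g) a) v = ρ g (e a (ρ g⁻¹ v))) :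
    P.IsBrCliffClass (h.centerIso hF hN) (BrCliff.mk A) := by
  obtain ⟨-, _⟩ := h.isGalois
  have hact (x : P.FN F) (v : V) : P.actFN ρ x v = lift l x • v := by
    induction x using MonoidAlgebra.induction_linear with
    | zero => simp
    | add x y hx hy => rw [map_add, map_add, LinearMap.add_apply, hx, hy, add_smul]
    | single n c =>
      rw [CliffordPair.actFN_single, lift_single, smul_assoc, LinearMap.smul_apply, hρ]
  -- Every scalar in $E$ acts as some element of $FN$, so commuting with $N$ forces $E$-linearity.
  have hlin {f : Module.End F V} (hf : f ∈ P.endFN ρ) (r : E) (v : V) :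
      f (r • v) = r • f v := by
    obtain ⟨x, rfl⟩ := h.lift_surjective r
    rw [← hact, ← hact]
    induction x using MonoidAlgebra.induction_linear with
    | zero => simp
    | add x y hx hy => simp only [map_add, LinearMap.add_apply, hx, hy]
    | single n c =>
      rw [CliffordPair.actFN_single, LinearMap.smul_apply, LinearMap.smul_apply, map_smul]
      exact congrArg _ (LinearMap.congr_fun
        ((Subalgebra.mem_centralizer_iff F).1 hf _ ⟨n, rfl⟩) v).symm
  let f : A.carrier →+* P.endFN ρ :=
    { toFun := fun a => ⟨(e a).restrictScalars F, by
        refine (Subalgebra.mem_centralizer_iff F).2 ?_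
        rintro _ ⟨n, rfl⟩
        ext v
        change ρ n (e a v) = e a (ρ n v)
        rw [hρ, hρ, map_smul]⟩
      map_one' := by ext; simp
      map_mul' := fun a b => by ext; simp
      map_zero' := by ext; simp
      map_add' := fun a b => by ext; simp }
  have hf : Function.Bijective f := by
    refine ⟨fun a b hab => e.injective (LinearMap.ext fun v =>
      LinearMap.congr_fun (congrArg Subtype.val hab) v), fun ψ => ?_⟩
    let ψ' : Module.End E V :=
      { toFun := (ψ : Module.End F V)
        map_add' := map_add _
        map_smul' := hlin ψ.2 }
    refine ⟨e.symm ψ', ?_⟩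
    ext v
    change e (e.symm ψ') v = _
    rw [AlgEquiv.apply_symm_apply]
    rfl
  refine ⟨V, _, _, ρ, A, ⟨inferInstance, Module.Finite.trans E V, ?_⟩,
    ⟨RingEquiv.ofBijective f hf, fun z => ?_, fun g a => ?_⟩, rfl⟩
  · ext v
    rw [hact, h.eG_eq hF, h.lift_eF, one_smul, Module.End.one_apply]
  · ext v
    rw [hact]
    change e (algebraMap E A.carrier (lift l z)) v = _
    rw [e.commutes, Module.algebraMap_end_apply]
  · ext v
    exact he g a v

end IsLinear

end CliffordPair

namespace ScalarKernelModule

variable {G : Type u} [Group G] {F : Subfield ℂ} {E : IntermediateField F ℂ}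
  [MulSemiringAction G E] (D : ScalarKernelModule G E)

/-- The pair consisting of the projection `H → G` and the linear character by which its kernel
acts. -/
def toCliffordPair : CliffordPair G where
  Ghat := D.H
  κ := D.κ
  surjective := D.surjective
  θ n := (D.scalarHom n : ℂ)
  irr := isIrrChar_of_monoidHom ((E.val : E →* ℂ).comp D.scalarHom)

variable {D}

theorem Generates.isLinear (h : D.Generates F) : D.toCliffordPair.IsLinear D.scalarHom where
  θ_eq _ := rfl
  adjoin_range := by
    refine top_le_iff.1 (h.symm.le.trans (Algebra.adjoin_mono ?_))
    rintro _ ⟨n, hn, rfl⟩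
    exact ⟨⟨n, hn⟩, rfl⟩
  map_conj g n := by
    refine Eq.trans ?_ (D.scalar_conj g n.2)
    exact congrArg D.scalar (MulAut.conjNormal_apply g n)

theorem Represents.exists_isBrCliffClass {c : BrCliff G E} (hc : D.Represents c)
    (h : D.Generates F) (hF : ∀ (g : G) (x : F), g • algebraMap F E x = algebraMap F E x)
    (hN : ∀ m n : D.κ.ker, m * n = n * m) :
    ∃ α : D.toCliffordPair.CenterIso F E, D.toCliffordPair.IsBrCliffClass α c := by
  obtain ⟨A, ⟨e, he⟩, rfl⟩ := hc
  let _ : Module F D.V := Module.compHom D.V (algebraMap F E)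
  have hsmul (c : F) (v : D.V) : c • v = algebraMap F E c • v := rfl
  have _ : IsScalarTower F E D.V := .of_algebraMap_smul fun _ _ => rfl
  let ρ : Representation F D.H D.V :=
    { toFun := fun g =>
        { toFun := D.σ.act g
          map_add' := map_add _
          map_smul' := fun c v => by
            rw [RingHom.id_apply, hsmul, hsmul, D.σ.act_smul, ← D.κ_smul, hF] }
      map_one' := by ext; simp
      map_mul' := fun g h => by ext; simp }
  exact ⟨_, h.isLinear.isBrCliffClass hF hN ρ (fun ⟨n, hn⟩ v => D.act_eq n hn v) A e
    fun g a v => LinearMap.congr_fun (he g a) v⟩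

end ScalarKernelModule

/-! ### Assembling the equalities. -/

theorem adjoin_gen_eq_top {F L : Type*} [Field F] [Field L] [Algebra F L] {x : L}
    (hx : IsOfFinOrder x) :
    ∃ y : IntermediateField.adjoin F {x}, IsOfFinOrder y ∧ Algebra.adjoin F {y} = ⊤ := by
  obtain ⟨n, hn, hxn⟩ := isOfFinOrder_iff_pow_eq_one.1 hx
  have hint : IsIntegral F x := IsIntegral.of_pow hn (hxn ▸ isIntegral_one)
  refine ⟨IntermediateField.AdjoinSimple.gen F x,
    isOfFinOrder_iff_pow_eq_one.2 ⟨n, hn, Subtype.ext hxn⟩, ?_⟩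
  exact (IntermediateField.adjoin.powerBasis hint).adjoin_gen_eq_top

/-- The classes represented by modules with scalars generating `E` are those of the pairs with
cyclic kernel, and also those of the pairs with abelian kernel. -/
theorem SC_eq_represented {G : Type u} [Group G] (F : Subfield ℂ) (E : IntermediateField F ℂ)
    [MulSemiringAction G E] (hF : ∀ (g : G) (x : F), g • algebraMap F E x = algebraMap F E x) :
    SC F E (cyclicKernelClass G F) =
        {c | ∃ D : ScalarKernelModule G E, D.Represents c ∧ D.Generates F} ∧
      SC F E (abelianKernelClass G F) =
        {c | ∃ D : ScalarKernelModule G E, D.Represents c ∧ D.Generates F} := by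
  have h₁ : SC F E (cyclicKernelClass G F) ⊆ SC F E (abelianKernelClass G F) := by
    rintro c ⟨P, ⟨hs, hcyc⟩, hc⟩
    exact ⟨P, ⟨hs, IsCyclic.isMulCommutative.is_comm.comm⟩, hc⟩
  have h₂ : SC F E (abelianKernelClass G F) ⊆
      {c | ∃ D : ScalarKernelModule G E, D.Represents c ∧ D.Generates F} := by
    rintro c ⟨P, ⟨-, hN⟩, α, hc⟩
    exact α.exists_scalarKernelModule hN hc
  have h₃ : {c | ∃ D : ScalarKernelModule G E, D.Represents c ∧ D.Generates F} ⊆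
      SC F E (cyclicKernelClass G F) := by
    rintro c ⟨D, hD, hgen⟩
    have hcyc := D.isCyclic_ker_reduce
    -- Reduction preserves both the class and the generation of $E$, and it makes the kernel cyclic.
    exact ⟨D.reduce.toCliffordPair, ⟨hgen.reduce.isLinear.isSemiInvariant hF, hcyc⟩,
      hD.reduce.exists_isBrCliffClass hgen.reduce hF IsCyclic.isMulCommutative.is_comm.comm⟩
  exact ⟨(h₁.trans h₂).antisymm h₃, h₂.antisymm (h₃.trans h₁)⟩

theorem corollaryc (G : Type u) [Group G] [Finite G] (F : Subfield ℂ) (ε : ℂ)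
    (hε : IsOfFinOrder ε) (E : IntermediateField F ℂ) (hE : E = IntermediateField.adjoin F {ε})
    [MulSemiringAction G E] (hF : ∀ (g : G) (x : F), g • algebraMap F E x = algebraMap F E x) :
    (∃ H : Subgroup (BrCliff G E), (H : Set (BrCliff G E)) = SC F E (cyclicKernelClass G F)) ∧
      SC F E (cyclicKernelClass G F) = SC F E (abelianKernelClass G F) := by
  obtain ⟨h₁, h₂⟩ := SC_eq_represented F E hF
  subst hE
  obtain ⟨y, hy, hgen⟩ := adjoin_gen_eq_top (F := F) hε
  exact ⟨⟨ScalarKernelModule.subgroup F hy hgen, h₁.symm⟩, h₁.trans h₂.symm⟩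

end
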